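/- Let $G$ be a compact Lie group, realised as a closed subgroup of some $U(n)$, with Lie algebra $\mathfrak g$ (skew-Hermitian matrices), $\mathfrak g^c=\mathfrak g\oplus i\mathfrak g$, $G^c=G\exp(i\mathfrak g)$, and let $\langle\cdot,\cdot\rangle$ be the Killing form, extended complex bilinearly to $\mathfrak g^c$. Let $\xi\in\mathfrak g$, let $K_\xi\subset G$ be its isotropy group, and let $$P_\xi=\{g\in G^c : e^{i\xi r}\,g\,e^{-i\xi r}\text{ is bounded as }r\to+\infty\},$$ with Lie algebra $\mathfrak p_\xi=\{Z\in\mathfrak g^c: e^{i\xi r}Ze^{-i\xi r}\text{ is bounded as }r\to+\infty\}$. Identify $G/K_\xi$ with the adjoint orbit $G\cdot\xi\subset\mathfrak g$, with tangent spaces $T_\eta=[\mathfrak g,\eta]$. It carries the complex structure $J[X,\eta]=[Y,\eta]$ for $X,Y\in\mathfrak g$ with $Y-iX\in\mathfrak p_\eta$, and the Kirillov--Kostant form $$\omega_\eta([X,\eta],[Y,\eta])=-\langle\eta,[X,Y]\rangle .$$ Let $f:S^2=\mathbb C\cup\{\infty\}\to G/K_\xi$ be a holomorphic map. Let $w$ denote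 either of the two standard coordinates on $S^2$ (the affine coordinate or its inverse), let $U\subset\mathbb C$ be an open set in the corresponding coordinate plane, and let $u:U\to G$, $p:U\to P_\xi$ be smooth maps such that $u$ is a lift of $f$ (that is, $f=u\xi u^{-1}$) and $up:U\to G^c$ is holomorphic. The approximate monopole of $f$ is the pair $(A,\Phi)$ on hyperbolic space, in coordinates $(w,r)$ with $r$ the distance to the origin, determined by the Hermitian metric $\mathcal H_f(w,r)=p^*e^{2i\xi r}p$ through $$A_{\bar w}=0,\quad A_w=\mathcal H_f^{-1}\partial_w\mathcal H_f,\quad A_r-i\Phi=0,\quad A_r+i\Phi=\mathcal H_f^{-1}\partial_r\mathcal H_f .$$ Let $F_A=dA+A\wedge A$ be its curvature. Then $F_A$ (restricted to the spheres $r=\text{const}$) and $\Phi$ are $\mathfrak g^c$-valued, and: 1. The gauge-invariant two-form $\langle F_A,\Phi\rangle$, restricted to the sphere of radius $r$, converges pointwise as $r\to\infty$, and its limit satisfies $$\langle F_A,\Phi\rangle|_{S^2_\infty}=f^*\omega .$$ 2. In the unitary gauge given by $s=e^{i\xi r}p$, the restriction of $sF_As^{-1}$ to the sphere of radius $r$ converges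 pointwise as $r\to\infty$ to a $\mathfrak g$-valued two-form $F_A|_{S^2_\infty}$, and $s\Phi s^{-1}$ converges to $\xi$; these limits satisfy $\langle F_A|_{S^2_\infty},\xi\rangle=f^*\omega$. 3. In terms of the lift, $$f^*\omega=\langle\xi,[u^{-1}\partial_wu,\,u^{-1}\partial_{\bar w}u]\rangle\,d\bar w\wedge dw .$$ -/

import Mathlib

open Complex Filter Topology Matrix
open scoped ContDiff

attribute [local instance] Matrix.linftyOpNormedRing Matrix.linftyOpNormedAlgebra
  LieRing.ofAssociativeRing

namespace HypMonopole

noncomputable section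

/-! ### The compact group `G`, its Lie algebra and their complexifications

A compact Lie group is realised as a closed subgroup `G` of the unitary group `U(n)`. -/

/-- `G` as a set of matrices. -/
def matSet {n : Type*} [Fintype n] [DecidableEq n]
    (G : Subgroup (Matrix.unitaryGroup n ℂ)) : Set (Matrix n n ℂ) :=
  {M | ∃ g ∈ G, (g : Matrix n n ℂ) = M}

/-- `X` is tangent to `G` at the identity: it is the velocity of a curve in `G` through `1`. -/
def IsTangent {n : Type*} [Fintype n] [DecidableEq n]
    (G : Subgroup (Matrix.unitaryGroup n ℂ)) (X : Matrix n n ℂ) : Prop :=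
  ∃ γ : ℝ → Matrix n n ℂ, γ 0 = 1 ∧ (∀ t, γ t ∈ matSet G) ∧ HasDerivAt γ X 0

/-- The tangent space of `G` at the identity as a real vector space. -/
def tangentSpace {n : Type*} [Fintype n] [DecidableEq n]
    (G : Subgroup (Matrix.unitaryGroup n ℂ)) : Submodule ℝ (Matrix n n ℂ) where
  carrier := {X | IsTangent G X}
  zero_mem' := ⟨fun _ => 1, rfl, fun _ => ⟨1, G.one_mem, rfl⟩, hasDerivAt_const _ _⟩
  add_mem' := by
    rintro X Y ⟨γ, h0, hm, hd⟩ ⟨δ, k0, km, kd⟩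
    refine ⟨fun t => γ t * δ t, by simp [h0, k0], fun t => ?_, ?_⟩
    · obtain ⟨a, ha, ha'⟩ := hm t
      obtain ⟨b, hb, hb'⟩ := km t
      exact ⟨a * b, G.mul_mem ha hb, by simp [ha', hb']⟩
    · have := hd.mul kd
      simp only [h0, k0, mul_one, one_mul] at this
      exact this
  smul_mem' := by
    rintro c X ⟨γ, h0, hm, hd⟩
    refine ⟨fun t => γ (c * t), by simp [h0], fun t => hm _, ?_⟩
    have h1 : HasDerivAt (fun t : ℝ => c * t) c 0 := by
      simpa using (hasDerivAt_id (0 : ℝ)).const_mul c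
    have h2 : HasDerivAt γ X (c * 0) := by simpa using hd
    exact h2.scomp 0 h1

theorem conj_mem_tangentSpace {n : Type*} [Fintype n] [DecidableEq n]
    (G : Subgroup (Matrix.unitaryGroup n ℂ)) {M X : Matrix n n ℂ}
    (hM : M ∈ matSet G) (hX : X ∈ tangentSpace G) : M * X * star M ∈ tangentSpace G := by
  obtain ⟨g, hg, rfl⟩ := hM
  obtain ⟨γ, h0, hm, hd⟩ := hX
  refine ⟨fun t => (g : Matrix n n ℂ) * γ t * star (g : Matrix n n ℂ), ?_, fun t => ?_, ?_⟩
  · simp [h0]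
  · obtain ⟨a, ha, ha'⟩ := hm t
    refine ⟨g * a * g⁻¹, G.mul_mem (G.mul_mem hg ha) (G.inv_mem hg), ?_⟩
    simp [ha']
  · exact (hd.const_mul _).mul_const _

/-- The Lie algebra `𝔤` of `G`, a real Lie algebra of skew-Hermitian matrices. -/
def lieAlg {n : Type*} [Fintype n] [DecidableEq n]
    (G : Subgroup (Matrix.unitaryGroup n ℂ)) : LieSubalgebra ℝ (Matrix n n ℂ) where
  toSubmodule := tangentSpace G
  lie_mem' := by
    rintro X Y ⟨γ, h0, hm, hd⟩ hY
    have hcl : IsClosed ((tangentSpace G : Submodule ℝ (Matrix n n ℂ)) : Set (Matrix n n ℂ)) :=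
      Submodule.closed_of_finiteDimensional _
    have hstar : HasDerivAt (fun t => star (γ t)) (star X) 0 :=
      ((starL' ℝ : Matrix n n ℂ ≃L[ℝ] Matrix n n ℂ).toContinuousLinearMap.hasFDerivAt).comp_hasDerivAt
        (0 : ℝ) hd
    have hskew : star X = - X := by
      have h1 : HasDerivAt (fun t => γ t * star (γ t)) (X * star (γ 0) + γ 0 * star X) 0 :=
        hd.mul hstar
      have h2 : (fun t => γ t * star (γ t)) = fun _ => (1 : Matrix n n ℂ) := by
        funext t
        obtain ⟨a, ha, ha'⟩ := hm t
        simp [← ha']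
      rw [h2] at h1
      have h3 := h1.unique (hasDerivAt_const (0 : ℝ) (1 : Matrix n n ℂ))
      simp only [h0, star_one, mul_one, one_mul] at h3
      exact eq_neg_of_add_eq_zero_right h3
    have h4 : HasDerivAt (fun t => γ t * Y * star (γ t)) (X * Y - Y * X) 0 := by
      have := (hd.mul_const Y).mul hstar
      simp only [h0, hskew, star_one, mul_one, one_mul, mul_neg, ← sub_eq_add_neg] at this
      exact this
    have h5 := h4.tendsto_slope
    have : X * Y - Y * X ∈ ((tangentSpace G : Submodule ℝ (Matrix n n ℂ)) : Set (Matrix n n ℂ)) := by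
      refine hcl.mem_of_tendsto h5 (Eventually.of_forall fun t => ?_)
      simp only [slope, vsub_eq_sub]
      refine Submodule.smul_mem _ _ (Submodule.sub_mem _ ?_ ?_)
      · exact conj_mem_tangentSpace G (hm t) hY
      · exact conj_mem_tangentSpace G (hm 0) hY
    simpa [Ring.lie_def] using this

/-- The complexified Lie algebra `𝔤ᶜ = 𝔤 ⊕ i𝔤` inside the complex matrices (the sum is direct
because the elements of `𝔤` are skew-Hermitian). -/
def lieAlgC {n : Type*} [Fintype n] [DecidableEq n]
    (G : Subgroup (Matrix.unitaryGroup n ℂ)) : LieSubalgebra ℂ (Matrix n n ℂ) where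
  carrier := {Z | ∃ X ∈ lieAlg G, ∃ Y ∈ lieAlg G, Z = X + I • Y}
  zero_mem' := ⟨0, zero_mem _, 0, zero_mem _, by simp⟩
  add_mem' := by
    rintro _ _ ⟨X, hX, Y, hY, rfl⟩ ⟨X', hX', Y', hY', rfl⟩
    exact ⟨X + X', add_mem hX hX', Y + Y', add_mem hY hY', by rw [smul_add]; abel⟩
  smul_mem' := by
    rintro c _ ⟨X, hX, Y, hY, rfl⟩
    refine ⟨c.re • X - c.im • Y, sub_mem ((lieAlg G).smul_mem _ hX) ((lieAlg G).smul_mem _ hY),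
      c.re • Y + c.im • X, add_mem ((lieAlg G).smul_mem _ hY) ((lieAlg G).smul_mem _ hX), ?_⟩
    ext a b
    apply Complex.ext <;> simp <;> ring
  lie_mem' := by
    rintro _ _ ⟨X, hX, Y, hY, rfl⟩ ⟨X', hX', Y', hY', rfl⟩
    refine ⟨⁅X, X'⁆ - ⁅Y, Y'⁆, sub_mem ((lieAlg G).lie_mem hX hX') ((lieAlg G).lie_mem hY hY'),
      ⁅X, Y'⁆ + ⁅Y, X'⁆, add_mem ((lieAlg G).lie_mem hX hY') ((lieAlg G).lie_mem hY hX'), ?_⟩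
    simp only [lie_add, add_lie, smul_lie, lie_smul, smul_add, smul_smul, I_mul_I, neg_smul,
      one_smul]
    abel

theorem mem_lieAlgC {n : Type*} [Fintype n] [DecidableEq n]
    {G : Subgroup (Matrix.unitaryGroup n ℂ)} {X : Matrix n n ℂ} (hX : X ∈ lieAlg G) :
    X ∈ lieAlgC G :=
  ⟨X, hX, 0, zero_mem _, by simp⟩

/-- The complexified group `Gᶜ = G · exp(i𝔤)` (polar decomposition). -/
def complexGroup {n : Type*} [Fintype n] [DecidableEq n]
    (G : Subgroup (Matrix.unitaryGroup n ℂ)) : Set (Matrix n n ℂ) :=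
  {M | ∃ g ∈ matSet G, ∃ X ∈ lieAlg G, M = g * NormedSpace.exp (I • X)}

open Classical in
/-- The Killing form of `𝔤ᶜ` (the complex bilinear extension of the Killing form of `𝔤`), as a
function of two matrices; it is only meaningful for matrices in `𝔤ᶜ` and is `0` elsewhere. -/
def killing {n : Type*} [Fintype n] [DecidableEq n]
    (G : Subgroup (Matrix.unitaryGroup n ℂ)) (Z W : Matrix n n ℂ) : ℂ :=
  if h : Z ∈ lieAlgC G ∧ W ∈ lieAlgC G then
    killingForm ℂ (lieAlgC G) ⟨Z, h.1⟩ ⟨W, h.2⟩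
  else 0

/-! ### The parabolic subgroup and the adjoint orbit -/

/-- `exp(iξr)`. -/
def expI {n : Type*} [Fintype n] [DecidableEq n] (ξ : Matrix n n ℂ) (r : ℝ) : Matrix n n ℂ :=
  NormedSpace.exp ((I * (r : ℂ)) • ξ)

/-- `exp(iξr) Z exp(-iξr)` stays bounded as `r → +∞`. -/
def BoundedAlong {n : Type*} [Fintype n] [DecidableEq n] (ξ Z : Matrix n n ℂ) : Prop :=
  ∃ C : ℝ, ∀ r : ℝ, 0 ≤ r → ‖expI ξ r * Z * expI ξ (-r)‖ ≤ C

/-- The parabolic subgroup `P_ξ` of `Gᶜ`. -/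
def parabolicGroup {n : Type*} [Fintype n] [DecidableEq n]
    (G : Subgroup (Matrix.unitaryGroup n ℂ)) (ξ : Matrix n n ℂ) : Set (Matrix n n ℂ) :=
  {M | M ∈ complexGroup G ∧ BoundedAlong ξ M}

/-- The parabolic subalgebra `𝔭_ξ` of `𝔤ᶜ`: the sum of the eigenspaces of `ad(iξ)` with
eigenvalue `≤ 0`. -/
def parabolicAlg {n : Type*} [Fintype n] [DecidableEq n]
    (G : Subgroup (Matrix.unitaryGroup n ℂ)) (ξ : Matrix n n ℂ) : Set (Matrix n n ℂ) :=
  {Z | Z ∈ lieAlgC G ∧ BoundedAlong ξ Z}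

/-- The adjoint orbit `G · ξ ≅ G / K_ξ`. -/
def adjointOrbit {n : Type*} [Fintype n] [DecidableEq n]
    (G : Subgroup (Matrix.unitaryGroup n ℂ)) (ξ : Matrix n n ℂ) : Set (Matrix n n ℂ) :=
  {η | ∃ g ∈ matSet G, η = g * ξ * g⁻¹}

/-- `b = J a` for tangent vectors `a = [X, η]`, `b = [Y, η]` of the adjoint orbit at `η`, where
`J` is the complex structure: `Y ≡ iX` modulo `𝔭_η`. -/
def IsJ {n : Type*} [Fintype n] [DecidableEq n]
    (G : Subgroup (Matrix.unitaryGroup n ℂ)) (η a b : Matrix n n ℂ) : Prop :=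
  ∃ X ∈ lieAlg G, ∃ Y ∈ lieAlg G, a = ⁅X, η⁆ ∧ b = ⁅Y, η⁆ ∧ Y - I • X ∈ parabolicAlg G η

open Classical in
/-- The Kirillov–Kostant form of the adjoint orbit at `η`, on tangent vectors `a = [X, η]` and
`b = [Y, η]` with `X, Y ∈ 𝔤`:  `ω_η(a, b) = -⟨η, [X, Y]⟩ = ⟨η, [Y, X]⟩`.
(It does not depend on `X`, `Y`: see `kirillovKostant_eq`.)  The overall sign is the one for which
the pull-back under `u · ξ` is `⟨ξ, [u⁻¹ ∂_w u, u⁻¹ ∂_w̄ u]⟩ dw̄ ∧ dw`, and for which, the Killing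
form being negative on `𝔤`, the metric `ω(J·, ·)` is positive. -/
def kirillovKostant {n : Type*} [Fintype n] [DecidableEq n]
    (G : Subgroup (Matrix.unitaryGroup n ℂ)) (η a b : Matrix n n ℂ) : ℂ :=
  if h : (∃ X ∈ lieAlg G, a = ⁅X, η⁆) ∧ (∃ Y ∈ lieAlg G, b = ⁅Y, η⁆) then
    -killing G η ⁅h.1.choose, h.2.choose⁆
  else 0

theorem killing_lie {n : Type*} [Fintype n] [DecidableEq n]
    (G : Subgroup (Matrix.unitaryGroup n ℂ)) {η X Y : Matrix n n ℂ} (hη : η ∈ lieAlgC G)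
    (hX : X ∈ lieAlgC G) (hY : Y ∈ lieAlgC G) :
    killing G η ⁅X, Y⁆ = killing G ⁅η, X⁆ Y := by
  have h1 : ⁅X, Y⁆ ∈ lieAlgC G := (lieAlgC G).lie_mem hX hY
  have h2 : ⁅η, X⁆ ∈ lieAlgC G := (lieAlgC G).lie_mem hη hX
  rw [killing, killing, dif_pos ⟨hη, h1⟩, dif_pos ⟨h2, hY⟩]
  exact (LieModule.traceForm_apply_lie_apply ℂ (lieAlgC G) (lieAlgC G) ⟨η, hη⟩ ⟨X, hX⟩
    ⟨Y, hY⟩).symm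

theorem kirillovKostant_eq {n : Type*} [Fintype n] [DecidableEq n]
    (G : Subgroup (Matrix.unitaryGroup n ℂ)) {η X Y : Matrix n n ℂ} (hη : η ∈ lieAlg G)
    (hX : X ∈ lieAlg G) (hY : Y ∈ lieAlg G) :
    kirillovKostant G η ⁅X, η⁆ ⁅Y, η⁆ = -killing G η ⁅X, Y⁆ := by
  have h : (∃ X' ∈ lieAlg G, ⁅X, η⁆ = ⁅X', η⁆) ∧ (∃ Y' ∈ lieAlg G, ⁅Y, η⁆ = ⁅Y', η⁆) :=
    ⟨⟨X, hX, rfl⟩, ⟨Y, hY, rfl⟩⟩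
  rw [kirillovKostant, dif_pos h]
  obtain ⟨hX', eX⟩ := h.1.choose_spec
  obtain ⟨hY', eY⟩ := h.2.choose_spec
  generalize h.1.choose = X' at *
  generalize h.2.choose = Y' at *
  have c := mem_lieAlgC hη
  have key : ∀ {A B : Matrix n n ℂ}, A ∈ lieAlg G → B ∈ lieAlg G →
      killing G η ⁅A, B⁆ = killing G ⁅η, A⁆ B := fun hA hB =>
    killing_lie G c (mem_lieAlgC hA) (mem_lieAlgC hB)
  have e1 : ⁅η, X'⁆ = ⁅η, X⁆ := by rw [← lie_skew, ← eX, lie_skew]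
  have e2 : ⁅η, Y'⁆ = ⁅η, Y⁆ := by rw [← lie_skew, ← eY, lie_skew]
  have neg2 : ∀ A : Matrix n n ℂ, A ∈ lieAlgC G → killing G η (-A) = -killing G η A := by
    intro A hA
    have hA' : -A ∈ lieAlgC G := neg_mem hA
    rw [killing, killing, dif_pos ⟨c, hA'⟩, dif_pos ⟨c, hA⟩, ← map_neg]
    rfl
  have sw : ∀ {A B : Matrix n n ℂ}, A ∈ lieAlg G → B ∈ lieAlg G →
      killing G η ⁅A, B⁆ = -killing G η ⁅B, A⁆ := by
    intro A B hA hB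
    rw [← neg2 _ ((lieAlgC G).lie_mem (mem_lieAlgC hB) (mem_lieAlgC hA)), lie_skew]
  rw [key hX' hY', e1, ← key hX hY', sw hX hY', key hY' hX, e2, ← key hY hX, sw hY hX, neg_neg]

/-! ### Holomorphic maps from the two-sphere

The two-sphere is `ℂ ∪ {∞}`, with the coordinates `w` and `1/w`. -/

open Classical in
/-- The inverses of the two holomorphic coordinates: `w ↦ w` and `w ↦ 1/w` (with `0 ↦ ∞`). -/
def sphereChart : Bool → ℂ → OnePoint ℂ
  | false, w => (w : OnePoint ℂ)
  | true, w => if w = 0 then OnePoint.infty else ((w⁻¹ : ℂ) : OnePoint ℂ)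

/-- `f : S² → G · ξ` is a (smooth) holomorphic map: `J ∂_x f = ∂_y f`, equivalently
`∂_x f + J ∂_y f = 0`, in both coordinates. -/
def IsHolomorphicMap {n : Type*} [Fintype n] [DecidableEq n]
    (G : Subgroup (Matrix.unitaryGroup n ℂ)) (ξ : Matrix n n ℂ)
    (f : OnePoint ℂ → Matrix n n ℂ) : Prop :=
  (∀ z, f z ∈ adjointOrbit G ξ) ∧
  ∀ i, ContDiff ℝ ∞ (fun w => f (sphereChart i w)) ∧
    ∀ w, IsJ G (f (sphereChart i w))
      (fderiv ℝ (fun w => f (sphereChart i w)) w 1)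
      (fderiv ℝ (fun w => f (sphereChart i w)) w I)

/-- The data defining the approximate monopole of `f` over an open set `U` of the `i`-th
coordinate plane: a smooth lift `u : U → G` of `f` and a smooth `p : U → P_ξ` such that
`u p : U → Gᶜ` is holomorphic. -/
structure IsLift {n : Type*} [Fintype n] [DecidableEq n]
    (G : Subgroup (Matrix.unitaryGroup n ℂ)) (ξ : Matrix n n ℂ)
    (f : OnePoint ℂ → Matrix n n ℂ) (i : Bool) (U : Set ℂ) (u p : ℂ → Matrix n n ℂ) : Prop where
  smooth_u : ContDiffOn ℝ ∞ u U
  smooth_p : ContDiffOn ℝ ∞ p U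
  mem_u : ∀ w ∈ U, u w ∈ matSet G
  mem_p : ∀ w ∈ U, p w ∈ parabolicGroup G ξ
  lift : ∀ w ∈ U, f (sphereChart i w) = u w * ξ * (u w)⁻¹
  holomorphic : DifferentiableOn ℂ (fun w => u w * p w) U

/-- The pull-back of the Kirillov–Kostant form by a map `φ` from a coordinate plane to the orbit,
evaluated on two real tangent vectors `v`, `v'` at `w`. -/
def pullbackKK {n : Type*} [Fintype n] [DecidableEq n]
    (G : Subgroup (Matrix.unitaryGroup n ℂ)) (φ : ℂ → Matrix n n ℂ) (w v v' : ℂ) : ℂ :=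
  kirillovKostant G (φ w) (fderiv ℝ φ w v) (fderiv ℝ φ w v')

/-- `∂_w u = (∂_x u - i ∂_y u) / 2`. -/
def dw {n : Type*} [Fintype n] [DecidableEq n] (u : ℂ → Matrix n n ℂ) (w : ℂ) : Matrix n n ℂ :=
  (1 / 2 : ℂ) • (fderiv ℝ u w 1 - I • fderiv ℝ u w I)

/-- `∂_w̄ u = (∂_x u + i ∂_y u) / 2`. -/
def dwbar {n : Type*} [Fintype n] [DecidableEq n] (u : ℂ → Matrix n n ℂ) (w : ℂ) :
    Matrix n n ℂ :=
  (1 / 2 : ℂ) • (fderiv ℝ u w 1 + I • fderiv ℝ u w I)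

/-! ### The pair `(A, Φ)` of a Hermitian metric

A point of hyperbolic space has coordinates `(w, r)`: `w` a complex coordinate on the sphere of
directions at the origin, and `r` the distance to the origin. -/

/-- The approximate Hermitian metric `p* exp(2iξr) p`. -/
def approxMetric {n : Type*} [Fintype n] [DecidableEq n] (ξ : Matrix n n ℂ)
    (p : ℂ → Matrix n n ℂ) : ℂ × ℝ → Matrix n n ℂ :=
  fun q => (p q.1)ᴴ * expI ξ (2 * q.2) * p q.1

/-- `H⁻¹ ∂_w H`. -/
def connW {n : Type*} [Fintype n] [DecidableEq n] (H : ℂ × ℝ → Matrix n n ℂ) (q : ℂ × ℝ) :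
    Matrix n n ℂ :=
  (H q)⁻¹ * ((1 / 2 : ℂ) • (fderiv ℝ H q (1, 0) - I • fderiv ℝ H q (I, 0)))

/-- `H⁻¹ ∂_r H`. -/
def logDerivR {n : Type*} [Fintype n] [DecidableEq n] (H : ℂ × ℝ → Matrix n n ℂ) (q : ℂ × ℝ) :
    Matrix n n ℂ :=
  (H q)⁻¹ * fderiv ℝ H q (0, 1)

/-- The connection form `A = A_w dw + A_w̄ dw̄ + A_r dr` of `H` in the holomorphic gauge, where
`A_w = H⁻¹ ∂_w H`, `A_w̄ = 0`, `A_r - iΦ = 0` and `A_r + iΦ = H⁻¹ ∂_r H`, evaluated on a tangent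
vector `x` at the point `q`. -/
def conn {n : Type*} [Fintype n] [DecidableEq n] (H : ℂ × ℝ → Matrix n n ℂ) (q x : ℂ × ℝ) :
    Matrix n n ℂ :=
  x.1 • connW H q + x.2 • ((1 / 2 : ℂ) • logDerivR H q)

/-- The Higgs field of `H` in the holomorphic gauge, from `A_r - iΦ = 0` and
`A_r + iΦ = H⁻¹ ∂_r H`. -/
def higgs {n : Type*} [Fintype n] [DecidableEq n] (H : ℂ × ℝ → Matrix n n ℂ) (q : ℂ × ℝ) :
    Matrix n n ℂ :=
  (1 / (2 * I) : ℂ) • logDerivR H q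

/-- The curvature `F_A = dA + A ∧ A` of the connection of `H`, evaluated on the tangent vectors
`x`, `y` at `q`. -/
def curv {n : Type*} [Fintype n] [DecidableEq n] (H : ℂ × ℝ → Matrix n n ℂ) (q x y : ℂ × ℝ) :
    Matrix n n ℂ :=
  fderiv ℝ (fun q' => conn H q' y) q x - fderiv ℝ (fun q' => conn H q' x) q y
    + ⁅conn H q x, conn H q y⁆

/-- The change `s = exp(iξr) p` from the holomorphic gauge to a unitary gauge; `s* s` is the
metric `approxMetric ξ p`. -/
def unitaryGauge {n : Type*} [Fintype n] [DecidableEq n] (ξ : Matrix n n ℂ)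
    (p : ℂ → Matrix n n ℂ) (q : ℂ × ℝ) : Matrix n n ℂ :=
  expI ξ q.2 * p q.1

end

end HypMonopole

/-! Write `a = u⁻¹ ∂_w̄ u` and `b = u⁻¹ ∂_w u`. Holomorphy of `up` says `∂_w̄ p = -a p`. Hence `a =
-(∂_w̄ p) p⁻¹` stays bounded under conjugation by `exp(iξr)`: the matrices with this property form a
finite-dimensional algebra, which is closed under differentiation and under inversion of its
invertible elements. The same then holds for `N = ∂_w a`.

On a sphere `r = const` only `A_w` survives, so the curvature is `∂_w̄ A_w dw̄ ∧ dw`.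
Differentiating the metric `p* exp(2iξr) p` and substituting `∂_w̄ p = -a p` gives `Φ = p⁻¹ ξ p`. In
the gauge `s = exp(iξr) p` the Higgs field becomes `ξ`, and the coefficient of the curvature becomes
`-N_r - N_r* - [a_r, a_r*]`, where `X_r = exp(iξr) X exp(-iξr)` (`dwbar_connW_approxMetric`).
Bounded conjugates converge, to matrices commuting with `ξ` (`BoundedAlong.exists_tendsto`), so the
curvature converges to a Hermitian multiple of `dw̄ ∧ dw`, which is skew-Hermitian on real tangent
vectors.

Pairing with `ξ` removes the quadratic term, since `⟨ξ, [A, A*]⟩ = ⟨[ξ, A], A*⟩ = 0` for `A = lim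
a_r`. It does not see the conjugation either, since `exp(iξr)` fixes `ξ`. What remains is `-⟨ξ, N +
N*⟩`, and the Maurer–Cartan equation `N + N* = -[b, a]` (`maurerCartan`) turns it into `⟨ξ, [b,
a]⟩`. This is the coefficient of `f^*ω` (`IsLift.pullbackKK_eq`). Invariance of the Killing form
under conjugation by `s` gives the same limit for `⟨F_A, Φ⟩`. -/

namespace HypMonopole

/-! ### Conjugations preserving `𝔤ᶜ` and invariance of the Killing form -/

section Algebra

variable {n : Type*} [Fintype n] [DecidableEq n] {G : Subgroup (Matrix.unitaryGroup n ℂ)}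

theorem star_eq_neg_of_mem_lieAlg {X : Matrix n n ℂ} (hX : X ∈ lieAlg G) : star X = -X := by
  obtain ⟨γ, h0, hm, hd⟩ := hX
  have hstar : HasDerivAt (fun t => star (γ t)) (star X) 0 :=
    ((starL' ℝ : Matrix n n ℂ ≃L[ℝ] Matrix n n ℂ).toContinuousLinearMap.hasFDerivAt).comp_hasDerivAt
      (0 : ℝ) hd
  have h1 : HasDerivAt (fun t => γ t * star (γ t)) (X * star (γ 0) + γ 0 * star X) 0 :=
    hd.mul hstar
  have h2 : (fun t => γ t * star (γ t)) = fun _ => (1 : Matrix n n ℂ) := by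
    funext t
    obtain ⟨a, ha, ha'⟩ := hm t
    simp [← ha']
  rw [h2] at h1
  have h3 := h1.unique (hasDerivAt_const (0 : ℝ) (1 : Matrix n n ℂ))
  simp only [h0, star_one, mul_one, one_mul] at h3
  exact eq_neg_of_add_eq_zero_right h3

theorem star_mem_lieAlgC {Z : Matrix n n ℂ} (hZ : Z ∈ lieAlgC G) : star Z ∈ lieAlgC G := by
  obtain ⟨X, hX, Y, hY, rfl⟩ := hZ
  refine ⟨-X, neg_mem hX, Y, hY, ?_⟩
  rw [star_add, star_smul, star_eq_neg_of_mem_lieAlg hX, star_eq_neg_of_mem_lieAlg hY]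
  simp

/-- The skew-Hermitian elements of `𝔤ᶜ` are those of `𝔤`. -/
theorem mem_lieAlg_of_star_eq_neg {Z : Matrix n n ℂ} (hZ : Z ∈ lieAlgC G) (h : star Z = -Z) :
    Z ∈ lieAlg G := by
  obtain ⟨X, hX, Y, hY, rfl⟩ := hZ
  rw [star_add, star_smul, star_eq_neg_of_mem_lieAlg hX, star_eq_neg_of_mem_lieAlg hY] at h
  have h1 : I • Y = 0 := by
    have h2 : (2 : ℂ) • (I • Y) = 0 := by
      have h3 : I • Y = -(I • Y) := by
        have h4 : -X + I • Y = -X + -(I • Y) := by simpa [add_comm] using h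
        exact add_left_cancel h4
      rw [two_smul]
      nth_rewrite 1 [h3]
      simp
    simpa using h2
  rw [h1, add_zero]
  exact hX

theorem isClosed_lieAlgC : IsClosed (lieAlgC G : Set (Matrix n n ℂ)) :=
  Submodule.closed_of_finiteDimensional (lieAlgC G).toSubmodule

/-- Conjugation by the invertible matrix `M` is an automorphism of `𝔤ᶜ`. -/
structure NormalizesC (G : Subgroup (Matrix.unitaryGroup n ℂ)) (M : Matrix n n ℂ) : Prop where
  isUnit_det : IsUnit M.det
  conj_mem : ∀ {Z}, Z ∈ lieAlgC G → M * Z * M⁻¹ ∈ lieAlgC G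
  conj_inv_mem : ∀ {Z}, Z ∈ lieAlgC G → M⁻¹ * Z * M ∈ lieAlgC G

namespace NormalizesC

theorem mul {M N : Matrix n n ℂ} (hM : NormalizesC G M) (hN : NormalizesC G N) :
    NormalizesC G (M * N) where
  isUnit_det := by rw [det_mul]; exact hM.1.mul hN.1
  conj_mem hZ := by
    have := hM.conj_mem (hN.conj_mem hZ)
    rw [Matrix.mul_inv_rev]
    simpa only [mul_assoc] using this
  conj_inv_mem hZ := by
    have := hN.conj_inv_mem (hM.conj_inv_mem hZ)
    rw [Matrix.mul_inv_rev]
    simpa only [mul_assoc] using this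

theorem of_mem_matSet {M : Matrix n n ℂ} (hM : M ∈ matSet G) : NormalizesC G M := by
  obtain ⟨g, hg, rfl⟩ := hM
  have h1 : (g : Matrix n n ℂ)⁻¹ = star (g : Matrix n n ℂ) :=
    Matrix.inv_eq_right_inv (by simp)
  have key : ∀ h ∈ G, ∀ Z ∈ lieAlgC G,
      (h : Matrix n n ℂ) * Z * star (h : Matrix n n ℂ) ∈ lieAlgC G := by
    rintro h hh _ ⟨X, hX, Y, hY, rfl⟩
    refine ⟨_, conj_mem_tangentSpace G ⟨h, hh, rfl⟩ hX, _,
      conj_mem_tangentSpace G ⟨h, hh, rfl⟩ hY, ?_⟩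
    simp [mul_add, add_mul]
  refine ⟨?_, fun hZ => ?_, fun hZ => ?_⟩
  · exact (Matrix.isUnit_iff_isUnit_det _).1 (Unitary.toUnits g).isUnit
  · rw [h1]; exact key g hg _ hZ
  · rw [h1]; simpa using key g⁻¹ (G.inv_mem hg) _ hZ

end NormalizesC

theorem hasSum_exp_apply {A : Type*} [NormedAddCommGroup A] [NormedSpace ℂ A] [CompleteSpace A]
    (T : A →L[ℂ] A) (V : A) :
    HasSum (fun k : ℕ => ((k.factorial : ℂ)⁻¹) • (T ^ k) V) (NormedSpace.exp T V) := by
  have := (NormedSpace.exp_series_hasSum_exp' (𝕂 := ℂ) T).mapL (ContinuousLinearMap.apply ℂ A V)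
  simpa using this

/-- `exp Z · W · exp (-Z) = exp (ad Z) W`. -/
theorem exp_mul_mul_exp_neg {A : Type*} [NormedRing A] [NormedAlgebra ℂ A] [CompleteSpace A]
    (Z W : A) :
    NormedSpace.exp Z * W * NormedSpace.exp (-Z) =
      NormedSpace.exp (ContinuousLinearMap.mul ℂ A Z - (ContinuousLinearMap.mul ℂ A).flip Z) W := by
  let _ : NormedAlgebra ℚ A := NormedAlgebra.restrictScalars ℚ ℂ A
  let _ : NormedAlgebra ℚ (A →L[ℂ] A) := NormedAlgebra.restrictScalars ℚ ℂ (A →L[ℂ] A)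
  have hL : ∀ V : A, NormedSpace.exp (ContinuousLinearMap.mul ℂ A Z) V = NormedSpace.exp Z * V := by
    intro V
    refine (hasSum_exp_apply _ V).unique ?_
    have hk : ∀ k : ℕ, (ContinuousLinearMap.mul ℂ A Z ^ k) V = Z ^ k * V := fun k => by
      induction k with
      | zero => simp
      | succ k ih => rw [pow_succ', pow_succ', mul_apply_eq_comp, ih]; simp [mul_assoc]
    simp only [hk, ← smul_mul_assoc]
    exact (NormedSpace.exp_series_hasSum_exp' (𝕂 := ℂ) Z).mul_right V
  have hR : ∀ V : A, NormedSpace.exp (-(ContinuousLinearMap.mul ℂ A).flip Z) V =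
      V * NormedSpace.exp (-Z) := by
    intro V
    refine (hasSum_exp_apply _ V).unique ?_
    have hk : ∀ k : ℕ, ((-(ContinuousLinearMap.mul ℂ A).flip Z) ^ k) V = V * (-Z) ^ k := fun k => by
      induction k with
      | zero => simp
      | succ k ih => rw [pow_succ', pow_succ, mul_apply_eq_comp, ih]; simp [mul_assoc]
    simp only [hk, ← mul_smul_comm]
    exact (NormedSpace.exp_series_hasSum_exp' (𝕂 := ℂ) (-Z)).mul_left V
  -- Left and right multiplication commute by associativity, so the exponential of their difference
  -- splits as a product.
  have hc : Commute (ContinuousLinearMap.mul ℂ A Z) (-(ContinuousLinearMap.mul ℂ A).flip Z) := by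
    ext V
    simp [mul_assoc]
  rw [sub_eq_add_neg, NormedSpace.exp_add_of_commute hc, mul_apply_eq_comp, hR, hL,
    mul_assoc]

/-- The conjugate is `exp (ad Z) W`, a limit of sums of iterated brackets; these lie in `𝔤ᶜ`, which
is closed because it is finite-dimensional. -/
theorem exp_conj_mem_lieAlgC {Z W : Matrix n n ℂ} (hZ : Z ∈ lieAlgC G) (hW : W ∈ lieAlgC G) :
    NormedSpace.exp Z * W * NormedSpace.exp (-Z) ∈ lieAlgC G := by
  set T := ContinuousLinearMap.mul ℂ (Matrix n n ℂ) Z -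
    (ContinuousLinearMap.mul ℂ (Matrix n n ℂ)).flip Z with hT
  have hexp : NormedSpace.exp Z * W * NormedSpace.exp (-Z) = NormedSpace.exp T W :=
    exp_mul_mul_exp_neg Z W
  rw [hexp]
  have hs : HasSum (fun k : ℕ => ((k.factorial : ℂ)⁻¹) • (T ^ k) W) (NormedSpace.exp T W) :=
    hasSum_exp_apply T W
  refine isClosed_lieAlgC.mem_of_tendsto hs (Eventually.of_forall fun s => ?_)
  refine sum_mem fun k hk => (lieAlgC G).smul_mem _ ?_
  clear hk
  induction k with
  | zero => simpa using hW
  | succ k ih =>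
    rw [pow_succ', mul_apply_eq_comp]
    have := (lieAlgC G).lie_mem hZ ih
    simpa [hT, Ring.lie_def] using this

theorem NormalizesC.exp {Z : Matrix n n ℂ} (hZ : Z ∈ lieAlgC G) :
    NormalizesC G (NormedSpace.exp Z) := by
  refine ⟨(Matrix.isUnit_iff_isUnit_det _).1 (Matrix.isUnit_exp Z), fun hW => ?_, fun hW => ?_⟩
  · rw [← Matrix.exp_neg]; exact exp_conj_mem_lieAlgC hZ hW
  · rw [← Matrix.exp_neg]
    simpa using exp_conj_mem_lieAlgC (neg_mem hZ) hW

theorem NormalizesC.of_mem_complexGroup {M : Matrix n n ℂ} (hM : M ∈ complexGroup G) :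
    NormalizesC G M := by
  obtain ⟨g, hg, X, hX, rfl⟩ := hM
  exact (NormalizesC.of_mem_matSet hg).mul
    (NormalizesC.exp ((lieAlgC G).smul_mem _ (mem_lieAlgC hX)))

theorem NormalizesC.expI {ξ : Matrix n n ℂ} (hξ : ξ ∈ lieAlg G) (r : ℝ) :
    NormalizesC G (expI ξ r) :=
  NormalizesC.exp ((lieAlgC G).smul_mem _ (mem_lieAlgC hξ))

/-- Conjugation by `M` as an automorphism of `𝔤ᶜ`. -/
noncomputable def NormalizesC.lieEquiv {M : Matrix n n ℂ} (hM : NormalizesC G M) :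
    lieAlgC G ≃ₗ⁅ℂ⁆ lieAlgC G where
  toFun Z := ⟨M * Z * M⁻¹, hM.conj_mem Z.2⟩
  invFun Z := ⟨M⁻¹ * Z * M, hM.conj_inv_mem Z.2⟩
  map_add' Z W := by ext1; simp [mul_add, add_mul]
  map_smul' c Z := by ext1; simp
  map_lie' := by
    intro Z W
    ext1
    simp only [LieSubalgebra.coe_bracket, Ring.lie_def, mul_sub, sub_mul]
    simp only [mul_assoc, Matrix.nonsing_inv_mul_cancel_left _ _ hM.isUnit_det]
  left_inv Z := by
    ext1
    simp only [mul_assoc, Matrix.nonsing_inv_mul_cancel_left _ _ hM.isUnit_det,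
      Matrix.nonsing_inv_mul _ hM.isUnit_det, mul_one]
  right_inv Z := by
    ext1
    simp only [mul_assoc, Matrix.mul_nonsing_inv_cancel_left _ _ hM.isUnit_det,
      Matrix.mul_nonsing_inv _ hM.isUnit_det, mul_one]

/-- The Killing form is invariant under every automorphism of the Lie algebra, in particular under
conjugation by `M`. -/
theorem NormalizesC.killing_conj {M Z W : Matrix n n ℂ} (hM : NormalizesC G M)
    (hZ : Z ∈ lieAlgC G) (hW : W ∈ lieAlgC G) :
    killing G (M * Z * M⁻¹) (M * W * M⁻¹) = killing G Z W := by
  rw [killing, killing, dif_pos ⟨hM.conj_mem hZ, hM.conj_mem hW⟩, dif_pos ⟨hZ, hW⟩]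
  exact LieAlgebra.killingForm_of_equiv_apply (R := ℂ) hM.lieEquiv ⟨Z, hZ⟩ ⟨W, hW⟩

/-- Pairing with a fixed element of `𝔤ᶜ` extends to a linear functional on all matrices. -/
theorem exists_killing_eq {η : Matrix n n ℂ} (hη : η ∈ lieAlgC G) :
    ∃ ℓ : Matrix n n ℂ →L[ℂ] ℂ, ∀ Z ∈ lieAlgC G, killing G η Z = ℓ Z := by
  obtain ⟨l, hl⟩ := LinearMap.exists_extend (p := (lieAlgC G).toSubmodule)
    (killingForm ℂ (lieAlgC G) ⟨η, hη⟩)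
  refine ⟨LinearMap.toContinuousLinearMap l, fun Z hZ => ?_⟩
  rw [killing, dif_pos ⟨hη, hZ⟩]
  exact (LinearMap.congr_fun hl ⟨Z, hZ⟩).symm

theorem killing_comm (Z W : Matrix n n ℂ) : killing G Z W = killing G W Z := by
  by_cases h : Z ∈ lieAlgC G ∧ W ∈ lieAlgC G
  · rw [killing, killing, dif_pos h, dif_pos h.symm]
    exact LieModule.traceForm_comm ℂ (lieAlgC G) (lieAlgC G) _ _
  · rw [killing, killing, dif_neg h, dif_neg (fun h' => h h'.symm)]

/-- Invariance moves the bracket onto `η`. This disposes of the quadratic term of the limiting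
curvature. -/
theorem killing_lie_eq_zero {η Z W : Matrix n n ℂ} (hη : η ∈ lieAlgC G) (hZ : Z ∈ lieAlgC G)
    (hW : W ∈ lieAlgC G) (h : ⁅η, Z⁆ = 0) : killing G η ⁅Z, W⁆ = 0 := by
  rw [killing_lie G hη hZ hW, h]
  rw [killing, dif_pos ⟨zero_mem _, hW⟩]
  exact LinearMap.map_zero₂ (killingForm ℂ (lieAlgC G)) _

end Algebra

/-! ### Conjugation by `exp(iξr)`: boundedness and limits -/

section Bounded

variable {n : Type*} [Fintype n] [DecidableEq n] {ξ : Matrix n n ℂ}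

theorem expI_add (ξ : Matrix n n ℂ) (r t : ℝ) : expI ξ (r + t) = expI ξ r * expI ξ t := by
  rw [expI, expI, expI, ← Matrix.exp_add_of_commute]
  · rw [← add_smul, ofReal_add, mul_add]
  · exact ((Commute.refl ξ).smul_left _).smul_right _

@[simp] theorem expI_zero (ξ : Matrix n n ℂ) : expI ξ 0 = 1 := by
  rw [expI]
  simp

@[simp] theorem expI_mul_expI_neg (ξ : Matrix n n ℂ) (r : ℝ) : expI ξ r * expI ξ (-r) = 1 := by
  rw [← expI_add, add_neg_cancel, expI_zero]

@[simp] theorem expI_neg_mul_expI (ξ : Matrix n n ℂ) (r : ℝ) : expI ξ (-r) * expI ξ r = 1 := by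
  rw [← expI_add, neg_add_cancel, expI_zero]

theorem inv_expI (ξ : Matrix n n ℂ) (r : ℝ) : (expI ξ r)⁻¹ = expI ξ (-r) :=
  Matrix.inv_eq_right_inv (expI_mul_expI_neg ξ r)

theorem star_expI (hξ : star ξ = -ξ) (r : ℝ) : star (expI ξ r) = expI ξ r := by
  have h : ((I * (r : ℂ)) • ξ)ᴴ = (I * (r : ℂ)) • ξ := by
    rw [← Matrix.star_eq_conjTranspose, star_smul, hξ]
    simp
  rw [expI, Matrix.star_eq_conjTranspose, ← Matrix.exp_conjTranspose, h]

theorem hasDerivAt_expI (ξ : Matrix n n ℂ) (r : ℝ) :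
    HasDerivAt (expI ξ) (expI ξ r * (I • ξ)) r := by
  have h := hasDerivAt_exp_smul_const (𝕂 := ℝ) (I • ξ) r
  have e : expI ξ = fun t : ℝ => NormedSpace.exp (t • (I • ξ)) := by
    funext t
    rw [expI, mul_comm, ← smul_smul]
    rfl
  rw [e]
  exact h

theorem commute_expI (ξ : Matrix n n ℂ) (r : ℝ) : Commute ξ (expI ξ r) := by
  have h : Commute ξ ((I * (r : ℂ)) • ξ) := (Commute.refl ξ).smul_right _
  exact h.exp_right

/-- The matrices that stay bounded under conjugation by `exp(iξr)`. -/
def boundedSubalgebra (ξ : Matrix n n ℂ) : Subalgebra ℂ (Matrix n n ℂ) where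
  carrier := {Z | BoundedAlong ξ Z}
  mul_mem' := by
    rintro Z W ⟨C, hC⟩ ⟨D, hD⟩
    refine ⟨C * D, fun r hr => ?_⟩
    have : expI ξ r * (Z * W) * expI ξ (-r) =
        (expI ξ r * Z * expI ξ (-r)) * (expI ξ r * W * expI ξ (-r)) := by
      calc _ = expI ξ r * Z * 1 * W * expI ξ (-r) := by noncomm_ring
        _ = _ := by rw [← expI_neg_mul_expI ξ r]; noncomm_ring
    rw [this]
    exact (norm_mul_le _ _).trans
      (mul_le_mul (hC r hr) (hD r hr) (norm_nonneg _) ((norm_nonneg _).trans (hC r hr)))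
  add_mem' := by
    rintro Z W ⟨C, hC⟩ ⟨D, hD⟩
    refine ⟨C + D, fun r hr => ?_⟩
    rw [mul_add, add_mul]
    exact (norm_add_le _ _).trans (add_le_add (hC r hr) (hD r hr))
  algebraMap_mem' := by
    intro c
    refine ⟨‖algebraMap ℂ (Matrix n n ℂ) c‖, fun r _ => ?_⟩
    rw [← Algebra.commutes, mul_assoc, expI_mul_expI_neg, mul_one]

/-- A subalgebra of matrices contains the inverses of its invertible elements. -/
theorem inv_mem_of_isUnit_det {B : Subalgebra ℂ (Matrix n n ℂ)} {M : Matrix n n ℂ}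
    (hM : M ∈ B) (hu : IsUnit M.det) : M⁻¹ ∈ B := by
  -- Left multiplication by `M` is an injective endomorphism of the finite-dimensional space `B`,
  -- hence surjective; a preimage of `1` is the inverse.
  have hinj : Function.Injective (LinearMap.mulLeft ℂ (⟨M, hM⟩ : B)) := by
    intro x y hxy
    have h : M * (x : Matrix n n ℂ) = M * y := congrArg Subtype.val hxy
    ext1
    rw [← Matrix.nonsing_inv_mul_cancel_left M x.1 hu, h,
      Matrix.nonsing_inv_mul_cancel_left M y.1 hu]
  obtain ⟨x, hx⟩ := (LinearMap.injective_iff_surjective.1 hinj) 1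
  have h : M * (x : Matrix n n ℂ) = 1 := congrArg Subtype.val hx
  rw [Matrix.inv_eq_right_inv h]
  exact x.2

/-- A skew-Hermitian matrix is diagonalisable with imaginary eigenvalues. -/
theorem exists_diagonalization (hξ : star ξ = -ξ) :
    ∃ (V : (Matrix n n ℂ)ˣ) (d : n → ℝ),
      ξ = V * diagonal (fun j => -I * (d j : ℂ)) * (V⁻¹ : (Matrix n n ℂ)ˣ) ∧
      ∀ r : ℝ, expI ξ r = V * diagonal (fun j => ((Real.exp (r * d j) : ℝ) : ℂ)) *
        (V⁻¹ : (Matrix n n ℂ)ˣ) := by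
  have hH : (I • ξ).IsHermitian := by
    rw [Matrix.IsHermitian, ← Matrix.star_eq_conjTranspose, star_smul, hξ]
    simp
  set V : (Matrix n n ℂ)ˣ := Unitary.toUnits hH.eigenvectorUnitary
  have h0 : I • ξ = V * diagonal (fun j => (hH.eigenvalues j : ℂ)) * (V⁻¹ : (Matrix n n ℂ)ˣ) := by
    have := hH.spectral_theorem
    rw [Unitary.conjStarAlgAut_apply] at this
    exact this
  have h1 : ξ = (-I) • (I • ξ) := by simp [smul_smul]
  have h2 : ∀ c : ℂ, c • (I • ξ) =
      V * diagonal (fun j => c * (hH.eigenvalues j : ℂ)) * (V⁻¹ : (Matrix n n ℂ)ˣ) := fun c => by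
    have h3 : diagonal (fun j => c * (hH.eigenvalues j : ℂ)) =
        c • diagonal (fun j => (hH.eigenvalues j : ℂ)) := by
      ext j k
      simp [Matrix.diagonal_apply]
    rw [h3, mul_smul_comm, smul_mul_assoc, ← h0]
  refine ⟨V, hH.eigenvalues, ?_, fun r => ?_⟩
  · rw [← h2, ← h1]
  · rw [expI, mul_comm, ← smul_smul, h2, Matrix.exp_units_conj, Matrix.exp_diagonal]
    congr 3
    funext j
    rw [Pi.coe_exp, ← Complex.exp_eq_exp_ℂ]
    push_cast
    rfl

/-- If `exp(iξr) Z exp(-iξr)` stays bounded, then it converges, to a matrix commuting with `ξ`. -/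
theorem BoundedAlong.exists_tendsto (hξ : star ξ = -ξ) {Z : Matrix n n ℂ}
    (hZ : BoundedAlong ξ Z) :
    ∃ L : Matrix n n ℂ, Tendsto (fun r : ℝ => expI ξ r * Z * expI ξ (-r)) atTop (𝓝 L) ∧
      ⁅ξ, L⁆ = 0 := by
  obtain ⟨V, d, hξd, hexp⟩ := exists_diagonalization hξ
  set W : Matrix n n ℂ := (V⁻¹ : (Matrix n n ℂ)ˣ) * Z * V with hW
  -- In an eigenbasis of `iξ` with eigenvalues `d`, conjugation scales the entry `(j, k)` by `exp(r
  -- (d j - d k))`.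
  have hconj : ∀ r : ℝ, expI ξ r * Z * expI ξ (-r) =
      V * Matrix.of (fun j k => ((Real.exp (r * (d j - d k)) : ℝ) : ℂ) * W j k) *
        (V⁻¹ : (Matrix n n ℂ)ˣ) := by
    intro r
    have : Matrix.of (fun j k => ((Real.exp (r * (d j - d k)) : ℝ) : ℂ) * W j k) =
        diagonal (fun j => ((Real.exp (r * d j) : ℝ) : ℂ)) * W *
          diagonal (fun j => ((Real.exp (-r * d j) : ℝ) : ℂ)) := by
      ext j k
      rw [Matrix.mul_diagonal, Matrix.diagonal_mul, Matrix.of_apply, mul_sub, sub_eq_add_neg,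
        Real.exp_add, neg_mul]
      push_cast
      ring
    rw [this, hexp, hexp, hW]
    simp only [mul_assoc]
  -- An entry with positive growth rate must vanish, as it would otherwise outgrow the bound on the
  -- conjugates.
  have hzero : ∀ j k, d k < d j → W j k = 0 := by
    intro j k hjk
    by_contra hne
    obtain ⟨C, hC⟩ := hZ
    have hent : ∀ M : Matrix n n ℂ, ‖M j k‖ ≤ ‖M‖ := fun M => by
      rw [Matrix.linfty_opNorm_def]
      have h1 : ‖M j k‖₊ ≤ ∑ l, ‖M j l‖₊ :=
        Finset.single_le_sum (f := fun l => ‖M j l‖₊) (fun _ _ => zero_le) (Finset.mem_univ k)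
      exact_mod_cast h1.trans (Finset.le_sup (f := fun i => ∑ l, ‖M i l‖₊) (Finset.mem_univ j))
    have hbd : ∀ r : ℝ, 0 ≤ r → Real.exp (r * (d j - d k)) * ‖W j k‖ ≤
        ‖((V⁻¹ : (Matrix n n ℂ)ˣ) : Matrix n n ℂ)‖ * C * ‖(V : Matrix n n ℂ)‖ := by
      intro r hr
      have h1 := hent ((V⁻¹ : (Matrix n n ℂ)ˣ) * (expI ξ r * Z * expI ξ (-r)) * V)
      have h2 : (V⁻¹ : (Matrix n n ℂ)ˣ) * (expI ξ r * Z * expI ξ (-r)) * V =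
          Matrix.of (fun j k => ((Real.exp (r * (d j - d k)) : ℝ) : ℂ) * W j k) := by
        rw [hconj]
        simp [mul_assoc]
      calc Real.exp (r * (d j - d k)) * ‖W j k‖
          = ‖((V⁻¹ : (Matrix n n ℂ)ˣ) * (expI ξ r * Z * expI ξ (-r)) * V) j k‖ := by
            rw [h2, Matrix.of_apply, norm_mul, Complex.norm_real, Real.norm_eq_abs, Real.abs_exp]
        _ ≤ _ := h1
        _ ≤ _ := (norm_mul_le _ _).trans
            (mul_le_mul_of_nonneg_right ((norm_mul_le _ _).trans
              (mul_le_mul_of_nonneg_left (hC r hr) (norm_nonneg _))) (norm_nonneg _))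
    have ht : Tendsto (fun r : ℝ => Real.exp (r * (d j - d k)) * ‖W j k‖) atTop atTop :=
      (Real.tendsto_exp_atTop.comp (tendsto_id.atTop_mul_const (sub_pos.2 hjk))).atTop_mul_const
        (norm_pos_iff.2 hne)
    obtain ⟨r, hr, hr0⟩ := ((ht.eventually_gt_atTop _).and (eventually_ge_atTop 0)).exists
    exact absurd (hbd r hr0) (not_le.2 hr)
  -- Entries with negative rate decay, so only those between equal eigenvalues survive; such a
  -- matrix commutes with the diagonal one.
  set W0 : Matrix n n ℂ := Matrix.of (fun j k => if d j = d k then W j k else 0) with hW0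
  refine ⟨V * W0 * (V⁻¹ : (Matrix n n ℂ)ˣ), ?_, ?_⟩
  · simp only [hconj]
    have hlim : Tendsto (fun r : ℝ =>
        Matrix.of (fun j k => ((Real.exp (r * (d j - d k)) : ℝ) : ℂ) * W j k)) atTop (𝓝 W0) := by
      refine tendsto_pi_nhds.2 fun j => tendsto_pi_nhds.2 fun k => ?_
      simp only [hW0, Matrix.of_apply]
      rcases lt_trichotomy (d j) (d k) with h | h | h
      · rw [if_neg h.ne]
        have h1 : Tendsto (fun r : ℝ => Real.exp (r * (d j - d k))) atTop (𝓝 0) :=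
          Real.tendsto_exp_atBot.comp (tendsto_id.atTop_mul_const_of_neg (sub_neg.2 h))
        have h2 := ((Complex.continuous_ofReal.tendsto 0).comp h1).mul_const (W j k)
        simpa using h2
      · rw [if_pos h]
        simp [h]
      · simp [hzero j k h]
    exact (hlim.const_mul _).mul_const _
  · have hc : diagonal (fun j => -I * (d j : ℂ)) * W0 = W0 * diagonal (fun j => -I * (d j : ℂ)) := by
      ext j k
      rw [Matrix.mul_diagonal, Matrix.diagonal_mul, hW0, Matrix.of_apply]
      split_ifs with h
      · rw [h]; ring
      · simp
    have h1 : ξ * (V * W0 * (V⁻¹ : (Matrix n n ℂ)ˣ)) =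
        V * (diagonal (fun j => -I * (d j : ℂ)) * W0) * (V⁻¹ : (Matrix n n ℂ)ˣ) := by
      rw [hξd]
      simp [mul_assoc]
    have h2 : (V * W0 * (V⁻¹ : (Matrix n n ℂ)ˣ)) * ξ =
        V * (W0 * diagonal (fun j => -I * (d j : ℂ))) * (V⁻¹ : (Matrix n n ℂ)ˣ) := by
      rw [hξd]
      simp [mul_assoc]
    rw [Ring.lie_def, h1, h2, hc, sub_self]

end Bounded

/-! ### Wirtinger calculus for matrix-valued maps -/

section Wirtinger

variable {n : Type*} [Fintype n] [DecidableEq n] {u p : ℂ → Matrix n n ℂ} {w : ℂ}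

theorem fderiv_eq_dw_add_dwbar (u : ℂ → Matrix n n ℂ) (w v : ℂ) :
    fderiv ℝ u w v = v • dw u w + (starRingEnd ℂ) v • dwbar u w := by
  have h : fderiv ℝ u w v = v.re • fderiv ℝ u w 1 + v.im • fderiv ℝ u w I := by
    rw [← map_smul, ← map_smul, ← map_add]
    congr 1
    apply Complex.ext <;> simp
  rw [h, dw, dwbar]
  ext j k
  have hv : v = v.re + v.im * I := (re_add_im v).symm
  have hv' : (starRingEnd ℂ) v = v.re - v.im * I := by
    apply Complex.ext <;> simp
  simp only [Matrix.add_apply, Matrix.smul_apply, Matrix.sub_apply, smul_eq_mul, real_smul]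
  rw [hv']
  nth_rewrite 3 [hv]
  linear_combination ((v.im : ℂ) * fderiv ℝ u w I j k) * I_mul_I

theorem dw_congr {u₁ u₂ : ℂ → Matrix n n ℂ} (h : u₁ =ᶠ[𝓝 w] u₂) : dw u₁ w = dw u₂ w := by
  rw [dw, dw, h.fderiv_eq]

theorem dwbar_congr {u₁ u₂ : ℂ → Matrix n n ℂ} (h : u₁ =ᶠ[𝓝 w] u₂) :
    dwbar u₁ w = dwbar u₂ w := by
  rw [dwbar, dwbar, h.fderiv_eq]

theorem fderiv_mul_apply (hu : DifferentiableAt ℝ u w) (hp : DifferentiableAt ℝ p w) (v : ℂ) :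
    fderiv ℝ (fun z => u z * p z) w v = u w * fderiv ℝ p w v + fderiv ℝ u w v * p w := by
  have h := (hu.hasFDerivAt.mul' hp.hasFDerivAt).fderiv
  have h1 := DFunLike.congr_fun h v
  simpa using! h1

theorem dw_mul (hu : DifferentiableAt ℝ u w) (hp : DifferentiableAt ℝ p w) :
    dw (fun z => u z * p z) w = dw u w * p w + u w * dw p w := by
  rw [dw, dw, dw, fderiv_mul_apply hu hp, fderiv_mul_apply hu hp]
  simp only [smul_add, smul_sub, mul_sub, sub_mul, smul_mul_assoc, mul_smul_comm]
  abel

theorem dwbar_mul (hu : DifferentiableAt ℝ u w) (hp : DifferentiableAt ℝ p w) :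
    dwbar (fun z => u z * p z) w = dwbar u w * p w + u w * dwbar p w := by
  rw [dwbar, dwbar, dwbar, fderiv_mul_apply hu hp, fderiv_mul_apply hu hp]
  simp only [smul_add, mul_add, add_mul, smul_mul_assoc, mul_smul_comm]
  abel

theorem dw_const (M : Matrix n n ℂ) : dw (fun _ => M) w = 0 := by
  simp [dw]

theorem dwbar_const (M : Matrix n n ℂ) : dwbar (fun _ => M) w = 0 := by
  simp [dwbar]

theorem dw_neg : dw (fun z => -u z) w = -dw u w := by
  have h : fderiv ℝ (fun z => -u z) w = -fderiv ℝ u w := fderiv_fun_neg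
  rw [dw, dw, h]
  simp only [_root_.neg_apply, smul_neg, smul_sub]
  abel

theorem dwbar_neg : dwbar (fun z => -u z) w = -dwbar u w := by
  have h : fderiv ℝ (fun z => -u z) w = -fderiv ℝ u w := fderiv_fun_neg
  rw [dwbar, dwbar, h]
  simp only [_root_.neg_apply, smul_neg, smul_add]
  abel

theorem dwbar_sub (hu : DifferentiableAt ℝ u w) (hp : DifferentiableAt ℝ p w) :
    dwbar (fun z => u z - p z) w = dwbar u w - dwbar p w := by
  have h : fderiv ℝ (fun z => u z - p z) w = fderiv ℝ u w - fderiv ℝ p w := fderiv_fun_sub hu hp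
  rw [dwbar, dwbar, dwbar, h]
  simp only [_root_.sub_apply, smul_sub, smul_add]
  abel

theorem differentiableAt_star (hu : DifferentiableAt ℝ u w) :
    DifferentiableAt ℝ (fun z => star (u z)) w :=
  (starL' ℝ : Matrix n n ℂ ≃L[ℝ] Matrix n n ℂ).differentiableAt.comp w hu

theorem fderiv_star_apply (u : ℂ → Matrix n n ℂ) (w v : ℂ) :
    fderiv ℝ (fun z => star (u z)) w v = star (fderiv ℝ u w v) := by
  have h : fderiv ℝ (fun z => star (u z)) w =
      ((starL' ℝ : Matrix n n ℂ ≃L[ℝ] Matrix n n ℂ) : Matrix n n ℂ →L[ℝ] Matrix n n ℂ).comp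
        (fderiv ℝ u w) :=
    (starL' ℝ : Matrix n n ℂ ≃L[ℝ] Matrix n n ℂ).comp_fderiv
  rw [h]
  rfl

theorem dw_star (u : ℂ → Matrix n n ℂ) (w : ℂ) :
    dw (fun z => star (u z)) w = star (dwbar u w) := by
  rw [dw, dwbar, fderiv_star_apply, fderiv_star_apply]
  simp [sub_eq_add_neg]

theorem dwbar_star (u : ℂ → Matrix n n ℂ) (w : ℂ) :
    dwbar (fun z => star (u z)) w = star (dw u w) := by
  rw [dw, dwbar, fderiv_star_apply, fderiv_star_apply]
  simp [sub_eq_add_neg]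

theorem dwbar_eq_zero (h : DifferentiableAt ℂ u w) : dwbar u w = 0 := by
  have h1 : fderiv ℝ u w I = I • fderiv ℝ u w 1 := by
    have h2 : fderiv ℝ u w = (fderiv ℂ u w).restrictScalars ℝ := h.fderiv_restrictScalars ℝ
    rw [h2, ContinuousLinearMap.coe_restrictScalars', ← map_smul]
    simp
  rw [dwbar, h1, smul_smul, I_mul_I]
  simp

theorem contDiffAt_fderiv_apply (h : ContDiffAt ℝ ∞ u w) (v : ℂ) :
    ContDiffAt ℝ ∞ (fun z => fderiv ℝ u z v) w :=
  (h.fderiv_right (m := ∞) le_rfl).clm_apply contDiffAt_const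

theorem contDiffAt_dw (h : ContDiffAt ℝ ∞ u w) : ContDiffAt ℝ ∞ (dw u) w :=
  ((contDiffAt_fderiv_apply h 1).sub ((contDiffAt_fderiv_apply h I).const_smul I)).const_smul _

theorem contDiffAt_dwbar (h : ContDiffAt ℝ ∞ u w) : ContDiffAt ℝ ∞ (dwbar u) w :=
  ((contDiffAt_fderiv_apply h 1).add ((contDiffAt_fderiv_apply h I).const_smul I)).const_smul _

/-- Both sides are the same combination of second real derivatives once these are known to be
symmetric. -/
theorem dwbar_dw_comm (h : ContDiffAt ℝ ∞ u w) : dwbar (dw u) w = dw (dwbar u) w := by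
  have hd : ∀ v, DifferentiableAt ℝ (fun z => fderiv ℝ u z v) w := fun v =>
    (contDiffAt_fderiv_apply h v).differentiableAt (by simp)
  have hd' : DifferentiableAt ℝ (fderiv ℝ u) w :=
    (h.fderiv_right (m := ∞) le_rfl).differentiableAt (by simp)
  have hv : ∀ v v', fderiv ℝ (fun z => fderiv ℝ u z v) w v' = fderiv ℝ (fderiv ℝ u) w v' v := by
    intro v v'
    have h := (hd'.hasFDerivAt.clm_apply (hasFDerivAt_const v w)).fderiv
    have h1 := DFunLike.congr_fun h v'
    refine h1.trans ?_
    change fderiv ℝ u w ((0 : ℂ →L[ℝ] ℂ) v') + fderiv ℝ (fderiv ℝ u) w v' v = _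
    simp
  have hsymm : fderiv ℝ (fderiv ℝ u) w 1 I = fderiv ℝ (fderiv ℝ u) w I 1 :=
    (h.isSymmSndFDerivAt (by rw [minSmoothness_of_isRCLikeNormedField]; exact WithTop.coe_le_coe.2 le_top)).eq 1 I
  have h1 : ∀ v, fderiv ℝ (dw u) w v =
      (1 / 2 : ℂ) • (fderiv ℝ (fderiv ℝ u) w v 1 - I • fderiv ℝ (fderiv ℝ u) w v I) := by
    intro v
    have : HasFDerivAt (fun z => dw u z) ((1 / 2 : ℂ) • (fderiv ℝ (fun z => fderiv ℝ u z 1) w -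
        I • fderiv ℝ (fun z => fderiv ℝ u z I) w)) w :=
      ((hd 1).hasFDerivAt.sub ((hd I).hasFDerivAt.const_smul I)).const_smul (1 / 2 : ℂ)
    rw [this.fderiv]
    simp [hv]
  have h2 : ∀ v, fderiv ℝ (dwbar u) w v =
      (1 / 2 : ℂ) • (fderiv ℝ (fderiv ℝ u) w v 1 + I • fderiv ℝ (fderiv ℝ u) w v I) := by
    intro v
    have : HasFDerivAt (fun z => dwbar u z) ((1 / 2 : ℂ) • (fderiv ℝ (fun z => fderiv ℝ u z 1) w +
        I • fderiv ℝ (fun z => fderiv ℝ u z I) w)) w :=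
      ((hd 1).hasFDerivAt.add ((hd I).hasFDerivAt.const_smul I)).const_smul (1 / 2 : ℂ)
    rw [this.fderiv]
    simp [hv]
  rw [dwbar, h1, h1, dw, h2, h2, hsymm]
  simp only [smul_add, smul_sub, smul_smul]
  ring_nf
  abel

theorem differentiableAt_inv (hp : DifferentiableAt ℝ p w) (hu : IsUnit (p w).det) :
    DifferentiableAt ℝ (fun z => (p z)⁻¹) w := by
  obtain ⟨x, hx⟩ := (Matrix.isUnit_iff_isUnit_det _).2 hu
  have h : DifferentiableAt ℝ (Ring.inverse : Matrix n n ℂ → Matrix n n ℂ) (p w) := by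
    rw [← hx]
    exact (hasFDerivAt_ringInverse (𝕜 := ℝ) x).differentiableAt
  simp only [Matrix.nonsing_inv_eq_ringInverse]
  exact h.comp w hp

theorem dwbar_inv (hp : DifferentiableAt ℝ p w) (hu : ∀ᶠ z in 𝓝 w, IsUnit (p z).det) :
    dwbar (fun z => (p z)⁻¹) w = -((p w)⁻¹ * dwbar p w * (p w)⁻¹) := by
  have hw := hu.self_of_nhds
  -- Differentiate `p⁻¹ p = 1`, valid near `w`, and solve for the derivative of the inverse.
  have h0 : dwbar (fun z => (p z)⁻¹ * p z) w = 0 := by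
    rw [dwbar_congr (u₂ := fun _ => 1) (hu.mono fun z hz => Matrix.nonsing_inv_mul _ hz),
      dwbar_const]
  rw [dwbar_mul (differentiableAt_inv hp hw) hp] at h0
  have h1 := congrArg (· * (p w)⁻¹) (eq_neg_of_add_eq_zero_left h0)
  simpa only [Matrix.mul_nonsing_inv_cancel_right _ _ hw, neg_mul] using h1

/-- The derivative of a map into a linear subspace lies in that subspace. -/
theorem fderiv_apply_mem (S : Submodule ℝ (Matrix n n ℂ)) (hu : DifferentiableAt ℝ u w)
    (hS : ∀ᶠ z in 𝓝 w, u z ∈ S) (v : ℂ) : fderiv ℝ u w v ∈ S := by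
  have hcl : IsClosed (S : Set (Matrix n n ℂ)) := Submodule.closed_of_finiteDimensional S
  have hd : HasDerivAt (fun t : ℝ => u (w + t • v)) (fderiv ℝ u w v) 0 :=
    (hu.hasFDerivAt.hasLineDerivAt v)
  have hc : Tendsto (fun t : ℝ => w + t • v) (𝓝[≠] 0) (𝓝 w) := by
    have : ContinuousAt (fun t : ℝ => w + t • v) 0 := by fun_prop
    have h2 : Tendsto (fun t : ℝ => w + t • v) (𝓝 0) (𝓝 w) := by simpa using this.tendsto
    exact h2.mono_left nhdsWithin_le_nhds
  -- The derivative is a limit of difference quotients, which lie in the closed subspace `S`.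
  refine hcl.mem_of_tendsto hd.tendsto_slope ((hc.eventually hS).mono fun t ht => ?_)
  simp only [slope, vsub_eq_sub]
  refine S.smul_mem _ (S.sub_mem ht ?_)
  simpa using hS.self_of_nhds

theorem dw_mem (S : Submodule ℂ (Matrix n n ℂ)) (hu : DifferentiableAt ℝ u w)
    (hS : ∀ᶠ z in 𝓝 w, u z ∈ S) : dw u w ∈ S :=
  S.smul_mem _ (S.sub_mem (fderiv_apply_mem (S.restrictScalars ℝ) hu hS 1)
    (S.smul_mem _ (fderiv_apply_mem (S.restrictScalars ℝ) hu hS I)))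

theorem dwbar_mem (S : Submodule ℂ (Matrix n n ℂ)) (hu : DifferentiableAt ℝ u w)
    (hS : ∀ᶠ z in 𝓝 w, u z ∈ S) : dwbar u w ∈ S :=
  S.smul_mem _ (S.add_mem (fderiv_apply_mem (S.restrictScalars ℝ) hu hS 1)
    (S.smul_mem _ (fderiv_apply_mem (S.restrictScalars ℝ) hu hS I)))

end Wirtinger

/-! ### The Maurer–Cartan form of a map into `G` -/

section MaurerCartan

variable {n : Type*} [Fintype n] [DecidableEq n] {G : Subgroup (Matrix.unitaryGroup n ℂ)}
  {u : ℂ → Matrix n n ℂ} {w : ℂ}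

theorem star_mul_self_of_mem_matSet {M : Matrix n n ℂ} (hM : M ∈ matSet G) : star M * M = 1 := by
  obtain ⟨g, -, rfl⟩ := hM
  simp

theorem mul_star_self_of_mem_matSet {M : Matrix n n ℂ} (hM : M ∈ matSet G) : M * star M = 1 := by
  obtain ⟨g, -, rfl⟩ := hM
  simp

theorem inv_eq_star_of_mem_matSet {M : Matrix n n ℂ} (hM : M ∈ matSet G) : M⁻¹ = star M :=
  Matrix.inv_eq_right_inv (mul_star_self_of_mem_matSet hM)

/-- The Maurer–Cartan form `u⁻¹ du` of a map into `G` has values in `𝔤`. -/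
theorem star_mul_fderiv_mem (hu : DifferentiableAt ℝ u w) (hm : ∀ᶠ z in 𝓝 w, u z ∈ matSet G)
    (v : ℂ) : star (u w) * fderiv ℝ u w v ∈ lieAlg G := by
  classical
  have hw := hm.self_of_nhds
  have hd : HasDerivAt (fun t : ℝ => u (w + t • v)) (fderiv ℝ u w v) 0 :=
    hu.hasFDerivAt.hasLineDerivAt v
  have hc : Tendsto (fun t : ℝ => w + t • v) (𝓝 0) (𝓝 w) := by
    have : ContinuousAt (fun t : ℝ => w + t • v) 0 := by fun_prop
    simpa using this.tendsto
  -- A tangent curve must stay in `G` for all times, while `u` is in `G` only near `w`; the value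
  -- `1` elsewhere does not affect the derivative at `0`.
  refine ⟨fun t => if u (w + t • v) ∈ matSet G then star (u w) * u (w + t • v) else 1, ?_,
    fun t => ?_, ?_⟩
  · simp [hw, star_mul_self_of_mem_matSet hw]
  · dsimp only
    split_ifs with h
    · obtain ⟨g, hg, hg'⟩ := hw
      obtain ⟨k, hk, hk'⟩ := h
      exact ⟨g⁻¹ * k, G.mul_mem (G.inv_mem hg) hk, by rw [← hg', ← hk']; simp⟩
    · exact ⟨1, G.one_mem, rfl⟩
  · refine (hd.const_mul (star (u w))).congr_of_eventuallyEq ?_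
    exact (hc.eventually hm).mono fun t ht => if_pos ht

theorem star_mul_dw_mem (hu : DifferentiableAt ℝ u w) (hm : ∀ᶠ z in 𝓝 w, u z ∈ matSet G) :
    star (u w) * dw u w ∈ lieAlgC G := by
  rw [dw, mul_smul_comm, mul_sub, mul_smul_comm]
  exact (lieAlgC G).smul_mem _ (sub_mem (mem_lieAlgC (star_mul_fderiv_mem hu hm 1))
    ((lieAlgC G).smul_mem _ (mem_lieAlgC (star_mul_fderiv_mem hu hm I))))

theorem star_mul_dwbar_mem (hu : DifferentiableAt ℝ u w) (hm : ∀ᶠ z in 𝓝 w, u z ∈ matSet G) :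
    star (u w) * dwbar u w ∈ lieAlgC G := by
  rw [dwbar, mul_smul_comm, mul_add, mul_smul_comm]
  exact (lieAlgC G).smul_mem _ (add_mem (mem_lieAlgC (star_mul_fderiv_mem hu hm 1))
    ((lieAlgC G).smul_mem _ (mem_lieAlgC (star_mul_fderiv_mem hu hm I))))

/-- This is `∂_w` applied to `u* u = 1`, using `∂_w (u*) = (∂_w̄ u)*`. -/
theorem star_star_mul_dwbar (hu : DifferentiableAt ℝ u w) (hm : ∀ᶠ z in 𝓝 w, u z ∈ matSet G) :
    star (star (u w) * dwbar u w) = -(star (u w) * dw u w) := by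
  have h : dw (fun z => star (u z) * u z) w = 0 := by
    rw [dw_congr (u₂ := fun _ => 1) (hm.mono fun z hz => star_mul_self_of_mem_matSet hz), dw_const]
  rw [dw_mul (differentiableAt_star hu) hu, dw_star] at h
  rw [star_mul, star_star]
  exact eq_neg_of_add_eq_zero_left h

/-- The Maurer–Cartan equation for a map into `G`. -/
theorem maurerCartan (hu : ContDiffAt ℝ ∞ u w) (hm : ∀ᶠ z in 𝓝 w, u z ∈ matSet G) :
    dw (fun z => star (u z) * dwbar u z) w + star (dw (fun z => star (u z) * dwbar u z) w) =
      -⁅star (u w) * dw u w, star (u w) * dwbar u w⁆ := by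
  have hd := hu.differentiableAt (by simp)
  have hw := hm.self_of_nhds
  -- The identity `a* = -b` is needed on a neighbourhood, since it is about to be differentiated.
  have hev : ∀ᶠ z in 𝓝 w, DifferentiableAt ℝ u z ∧ ∀ᶠ z' in 𝓝 z, u z' ∈ matSet G := by
    refine Eventually.and ?_ hm.eventually_nhds
    have h1 : ContDiffAt ℝ 1 u w := hu.of_le (by exact_mod_cast le_top)
    exact (h1.eventually (by simp)).mono fun z hz => hz.differentiableAt (by simp)
  have e1 : star (dw (fun z => star (u z) * dwbar u z) w) =
      -dwbar (fun z => star (u z) * dw u z) w := by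
    rw [← dwbar_star, ← dwbar_neg]
    exact dwbar_congr (hev.mono fun z hz => star_star_mul_dwbar hz.1 hz.2)
  have e2 := star_star_mul_dwbar hd hm
  have e3 : dw u w = u w * (star (u w) * dw u w) := by
    rw [← mul_assoc, mul_star_self_of_mem_matSet hw, one_mul]
  have e4 : dwbar u w = u w * (star (u w) * dwbar u w) := by
    rw [← mul_assoc, mul_star_self_of_mem_matSet hw, one_mul]
  have hs := differentiableAt_star hd
  have c1 : DifferentiableAt ℝ (fun z => dw u z) w :=
    (contDiffAt_dw hu).differentiableAt (by simp)
  have c2 : DifferentiableAt ℝ (fun z => dwbar u z) w :=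
    (contDiffAt_dwbar hu).differentiableAt (by simp)
  rw [e1, dw_mul hs c2, dwbar_mul hs c1, dw_star, dwbar_star,
    show dwbar (fun z => dw u z) w = dw (fun z => dwbar u z) w from dwbar_dw_comm hu]
  -- The second derivatives now cancel. Inserting `u u* = 1` writes the remaining first-order
  -- products in terms of `a` and `b`.
  have e5 : star (dwbar u w) * dwbar u w =
      -(star (u w) * dw u w) * (star (u w) * dwbar u w) := by
    rw [← e2, star_mul, star_star]
    nth_rewrite 2 [e4]
    rw [mul_assoc]
  have e6 : star (dw u w) * dw u w = -(star (u w) * dwbar u w) * (star (u w) * dw u w) := by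
    have : star (u w) * dwbar u w = -star (star (u w) * dw u w) := by
      rw [← star_neg, ← e2, star_star]
    rw [this, neg_neg, star_mul, star_star]
    nth_rewrite 2 [e3]
    rw [mul_assoc]
  rw [e5, e6, Ring.lie_def]
  noncomm_ring

/-- The derivative of `u ξ u⁻¹` is the bracket of `du u⁻¹` with it. -/
theorem fderiv_conj (ξ : Matrix n n ℂ) (hu : DifferentiableAt ℝ u w)
    (hm : ∀ᶠ z in 𝓝 w, u z ∈ matSet G) (v : ℂ) :
    fderiv ℝ (fun z => u z * ξ * star (u z)) w v =
      ⁅u w * (star (u w) * fderiv ℝ u w v) * star (u w), u w * ξ * star (u w)⁆ := by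
  have hw := hm.self_of_nhds
  have hs := differentiableAt_star hu
  -- Skewness of `u* du`, from the derivative of `u* u = 1`.
  have h0 : star (u w) * fderiv ℝ u w v + star (fderiv ℝ u w v) * u w = 0 := by
    rw [← fderiv_star_apply, ← fderiv_mul_apply hs hu,
      (show (fun z => star (u z) * u z) =ᶠ[𝓝 w] fun _ => 1 from
        hm.mono fun z hz => star_mul_self_of_mem_matSet hz).fderiv_eq]
    simp
  have h1 : DifferentiableAt ℝ (fun z => u z * ξ) w := hu.mul_const ξ
  have h2 : fderiv ℝ (fun z => u z * ξ) w v = fderiv ℝ u w v * ξ := by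
    have := fderiv_mul_apply hu (differentiableAt_const ξ) v
    simpa using this
  rw [fderiv_mul_apply h1 hs, fderiv_star_apply, h2, Ring.lie_def]
  have a1 : u w * (star (u w) * fderiv ℝ u w v) * star (u w) * (u w * ξ * star (u w)) =
      fderiv ℝ u w v * ξ * star (u w) := by
    rw [← mul_assoc (u w), mul_star_self_of_mem_matSet hw, one_mul, mul_assoc (u w),
      mul_assoc, ← mul_assoc (star (u w)), star_mul_self_of_mem_matSet hw, one_mul, mul_assoc]
  have a2 : u w * ξ * star (u w) * (u w * (star (u w) * fderiv ℝ u w v) * star (u w)) =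
      -(u w * ξ * star (fderiv ℝ u w v)) := by
    rw [eq_neg_of_add_eq_zero_left h0]
    calc _ = u w * ξ * (star (u w) * u w) * -(star (fderiv ℝ u w v)) * (u w * star (u w)) := by
          noncomm_ring
      _ = _ := by
          rw [star_mul_self_of_mem_matSet hw, mul_star_self_of_mem_matSet hw]
          noncomm_ring
  rw [a1, a2]
  abel

end MaurerCartan

/-! ### The pulled-back form and the consequences of holomorphy of `up` -/

section Lift

variable {n : Type*} [Fintype n] [DecidableEq n] {G : Subgroup (Matrix.unitaryGroup n ℂ)}
  {ξ : Matrix n n ℂ} {f : OnePoint ℂ → Matrix n n ℂ} {i : Bool} {U : Set ℂ}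
  {u p : ℂ → Matrix n n ℂ} {w : ℂ}

/-- `f^*ω = ⟨ξ, [u⁻¹ ∂_w u, u⁻¹ ∂_w̄ u]⟩ dw̄ ∧ dw`. -/
theorem IsLift.pullbackKK_eq (hup : IsLift G ξ f i U u p) (hU : IsOpen U) (hξ : ξ ∈ lieAlg G)
    (hw : w ∈ U) (v v' : ℂ) :
    pullbackKK G (fun z => f (sphereChart i z)) w v v' =
      killing G ξ ⁅star (u w) * dw u w, star (u w) * dwbar u w⁆ *
        ((starRingEnd ℂ) v * v' - v * (starRingEnd ℂ) v') := by
  have hm : ∀ᶠ z in 𝓝 w, u z ∈ matSet G := (hU.mem_nhds hw |> Filter.eventually_of_mem) hup.mem_u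
  have hd : DifferentiableAt ℝ u w :=
    (hup.smooth_u.contDiffAt (hU.mem_nhds hw)).differentiableAt (by simp)
  have hf : (fun z => f (sphereChart i z)) =ᶠ[𝓝 w] fun z => u z * ξ * star (u z) := by
    filter_upwards [hU.mem_nhds hw] with z hz
    rw [hup.lift z hz, inv_eq_star_of_mem_matSet (hup.mem_u z hz)]
  have huw := hup.mem_u w hw
  have hX := fun v => star_mul_fderiv_mem hd hm v
  have hη : u w * ξ * star (u w) ∈ lieAlg G := conj_mem_tangentSpace G huw hξ
  have hN := NormalizesC.of_mem_matSet huw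
  have hb := star_mul_dw_mem hd hm
  have ha := star_mul_dwbar_mem hd hm
  have hfw : f (sphereChart i w) = u w * ξ * star (u w) := hf.self_of_nhds
  rw [pullbackKK, hf.fderiv_eq, hfw, fderiv_conj ξ hd hm, fderiv_conj ξ hd hm,
    kirillovKostant_eq G hη (conj_mem_tangentSpace G huw (hX v))
      (conj_mem_tangentSpace G huw (hX v'))]
  have e1 : ⁅u w * (star (u w) * fderiv ℝ u w v) * star (u w),
      u w * (star (u w) * fderiv ℝ u w v') * star (u w)⁆ =
      u w * ⁅star (u w) * fderiv ℝ u w v, star (u w) * fderiv ℝ u w v'⁆ * star (u w) := by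
    have key : ∀ X Y : Matrix n n ℂ, u w * X * star (u w) * (u w * Y * star (u w)) =
        u w * (X * Y) * star (u w) := fun X Y => by
      calc _ = u w * X * (star (u w) * u w) * Y * star (u w) := by noncomm_ring
        _ = _ := by rw [star_mul_self_of_mem_matSet huw]; noncomm_ring
    rw [Ring.lie_def, Ring.lie_def, key, key, mul_sub, sub_mul]
  -- Expanding `[v b + v̄ a, v' b + v̄' a]` leaves only the mixed terms; the sign produced here
  -- cancels the one in the definition of `ω`.
  have e2 : ⁅star (u w) * fderiv ℝ u w v, star (u w) * fderiv ℝ u w v'⁆ =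
      -(((starRingEnd ℂ) v * v' - v * (starRingEnd ℂ) v') •
        ⁅star (u w) * dw u w, star (u w) * dwbar u w⁆) := by
    rw [fderiv_eq_dw_add_dwbar u w v, fderiv_eq_dw_add_dwbar u w v']
    simp only [mul_add, mul_smul_comm]
    generalize star (u w) * dw u w = b
    generalize star (u w) * dwbar u w = a
    simp only [Ring.lie_def, add_mul, mul_add, smul_mul_assoc, mul_smul_comm]
    module
  rw [e1, ← inv_eq_star_of_mem_matSet huw, hN.killing_conj (mem_lieAlgC hξ)
    ((lieAlgC G).lie_mem (mem_lieAlgC (by rw [inv_eq_star_of_mem_matSet huw]; exact hX v))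
      (mem_lieAlgC (by rw [inv_eq_star_of_mem_matSet huw]; exact hX v'))),
    inv_eq_star_of_mem_matSet huw, e2]
  -- `killing` is defined by cases on membership in `𝔤ᶜ`, so its linearity is used through the
  -- functional `ℓ`.
  obtain ⟨ℓ, hℓ⟩ := exists_killing_eq (mem_lieAlgC hξ)
  have hba := (lieAlgC G).lie_mem hb ha
  rw [hℓ _ (neg_mem ((lieAlgC G).smul_mem _ hba)), hℓ _ hba, map_neg, map_smul, neg_neg,
    smul_eq_mul, mul_comm]

/-- Expand `∂_w̄ (up) = 0` by the product rule and multiply by `u* = u⁻¹`. -/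
theorem IsLift.dwbar_p (hup : IsLift G ξ f i U u p) (hU : IsOpen U) (hw : w ∈ U) :
    dwbar p w = -(star (u w) * dwbar u w * p w) := by
  have hn := hU.mem_nhds hw
  have hd : DifferentiableAt ℝ u w := (hup.smooth_u.contDiffAt hn).differentiableAt (by simp)
  have hp : DifferentiableAt ℝ p w := (hup.smooth_p.contDiffAt hn).differentiableAt (by simp)
  have h := dwbar_eq_zero (hup.holomorphic.differentiableAt hn)
  rw [dwbar_mul hd hp] at h
  have h1 := congrArg (star (u w) * ·) (eq_neg_of_add_eq_zero_right h)
  simpa only [← mul_assoc, star_mul_self_of_mem_matSet (hup.mem_u w hw), one_mul, mul_neg] using h1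

theorem IsLift.isUnit_det (hup : IsLift G ξ f i U u p) (hw : w ∈ U) : IsUnit (p w).det :=
  (NormalizesC.of_mem_complexGroup (hup.mem_p w hw).1).isUnit_det

/-- By the previous equation this is `-(∂_w̄ p) p⁻¹`. Since `p` takes values in the algebra of
bounded matrices, so do its derivative and its inverse. -/
theorem IsLift.bounded_star_mul_dwbar (hup : IsLift G ξ f i U u p) (hU : IsOpen U) (hw : w ∈ U) :
    star (u w) * dwbar u w ∈ boundedSubalgebra ξ := by
  have hn := hU.mem_nhds hw
  have hp : DifferentiableAt ℝ p w := (hup.smooth_p.contDiffAt hn).differentiableAt (by simp)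
  have h1 : star (u w) * dwbar u w = -(dwbar p w) * (p w)⁻¹ := by
    rw [hup.dwbar_p hU hw, neg_neg, Matrix.mul_nonsing_inv_cancel_right _ _ (hup.isUnit_det hw)]
  rw [h1]
  refine mul_mem (neg_mem ?_) (inv_mem_of_isUnit_det (hup.mem_p w hw).2 (hup.isUnit_det hw))
  exact dwbar_mem (Subalgebra.toSubmodule (boundedSubalgebra ξ)) hp
    (Filter.eventually_of_mem hn fun z hz => (hup.mem_p z hz).2)

end Lift

/-! ### Higgs field, connection and curvature of the approximate metric -/

section Curvature

variable {n : Type*} [Fintype n] [DecidableEq n] {ξ : Matrix n n ℂ} {p : ℂ → Matrix n n ℂ} {w : ℂ}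

theorem fderiv_apply_fst {F : ℂ × ℝ → Matrix n n ℂ} {r : ℝ} (hF : DifferentiableAt ℝ F (w, r))
    (v : ℂ) : fderiv ℝ F (w, r) (v, 0) = fderiv ℝ (fun z => F (z, r)) w v := by
  have h0 : HasFDerivAt (𝕜 := ℝ) (fun z : ℂ => (z, r)) (ContinuousLinearMap.inl ℝ ℂ ℝ) w :=
    hasFDerivAt_prodMk_left w r
  have h := (hF.hasFDerivAt.comp w h0).fderiv
  exact (DFunLike.congr_fun h v).symm

theorem fderiv_apply_snd {F : ℂ × ℝ → Matrix n n ℂ} {r : ℝ} {D : Matrix n n ℂ}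
    (hF : DifferentiableAt ℝ F (w, r)) (hD : HasDerivAt (fun t => F (w, t)) D r) :
    fderiv ℝ F (w, r) (0, 1) = D := by
  have h0 : HasFDerivAt (𝕜 := ℝ) (fun t : ℝ => (w, t)) (ContinuousLinearMap.inr ℝ ℂ ℝ) r :=
    hasFDerivAt_prodMk_right w r
  have h := (hF.hasFDerivAt.comp r h0).unique hD.hasFDerivAt
  have h1 := DFunLike.congr_fun h 1
  exact h1.trans (one_smul ℝ D)

theorem differentiableAt_expI (ξ : Matrix n n ℂ) (r : ℝ) : DifferentiableAt ℝ (expI ξ) r :=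
  (hasDerivAt_expI ξ r).differentiableAt

theorem differentiableAt_approxMetric (hp : DifferentiableAt ℝ p w) (r : ℝ) :
    DifferentiableAt ℝ (approxMetric ξ p) (w, r) := by
  have h1 : DifferentiableAt ℝ (fun q : ℂ × ℝ => p q.1) (w, r) :=
    DifferentiableAt.comp (w, r) (f := Prod.fst) (g := p) hp differentiableAt_fst
  have h2 : DifferentiableAt ℝ (fun q : ℂ × ℝ => star (p q.1)) (w, r) :=
    DifferentiableAt.comp (w, r) (f := Prod.fst) (g := fun z => star (p z))
      (differentiableAt_star hp) differentiableAt_fst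
  have h3 : DifferentiableAt ℝ (fun q : ℂ × ℝ => expI ξ (2 * q.2)) (w, r) :=
    DifferentiableAt.comp (w, r) (f := fun q : ℂ × ℝ => 2 * q.2) (g := expI ξ)
      (differentiableAt_expI ξ _) (differentiableAt_snd.const_mul 2)
  exact (h2.mul h3).mul h1

theorem inv_approxMetric (ξ : Matrix n n ℂ) (p : ℂ → Matrix n n ℂ) (q : ℂ × ℝ) :
    (approxMetric ξ p q)⁻¹ = (p q.1)⁻¹ * expI ξ (-(2 * q.2)) * (star (p q.1))⁻¹ := by
  rw [approxMetric, Matrix.mul_inv_rev, Matrix.mul_inv_rev, inv_expI, mul_assoc]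
  rfl

theorem isUnit_det_star {M : Matrix n n ℂ} (hM : IsUnit M.det) : IsUnit (star M).det := by
  rw [Matrix.star_eq_conjTranspose, Matrix.det_conjTranspose]
  exact hM.star

/-- The Higgs field is `p⁻¹ ξ p`. -/
theorem higgs_approxMetric (hp : DifferentiableAt ℝ p w) (hu : IsUnit (p w).det) (r : ℝ) :
    higgs (approxMetric ξ p) (w, r) = (p w)⁻¹ * ξ * p w := by
  have hd : HasDerivAt (fun t : ℝ => approxMetric ξ p (w, t))
      (star (p w) * ((2 : ℝ) • (expI ξ (2 * r) * (I • ξ))) * p w) r := by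
    have h1 : HasDerivAt (fun t : ℝ => 2 * t) 2 r := by
      simpa using (hasDerivAt_id r).const_mul 2
    have h2 : HasDerivAt (fun t : ℝ => expI ξ (2 * t)) ((2 : ℝ) • (expI ξ (2 * r) * (I • ξ))) r :=
      (hasDerivAt_expI ξ (2 * r)).scomp r h1
    exact (h2.const_mul (star (p w))).mul_const (p w)
  have e1 : (p w)⁻¹ * expI ξ (-(2 * r)) * (star (p w))⁻¹ *
      (star (p w) * ((2 : ℝ) • (expI ξ (2 * r) * (I • ξ))) * p w) =
      (2 * I : ℂ) • ((p w)⁻¹ * ξ * p w) := by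
    have e2 : (2 : ℝ) • (expI ξ (2 * r) * (I • ξ)) = (2 * I : ℂ) • (expI ξ (2 * r) * ξ) := by
      rw [mul_smul_comm, ← smul_smul]
      ext j k
      simp
    rw [e2]
    simp only [mul_smul_comm, smul_mul_assoc]
    congr 1
    calc _ = (p w)⁻¹ * expI ξ (-(2 * r)) * ((star (p w))⁻¹ * star (p w)) * expI ξ (2 * r) * ξ *
          p w := by noncomm_ring
      _ = (p w)⁻¹ * (expI ξ (-(2 * r)) * expI ξ (2 * r)) * ξ * p w := by
        rw [Matrix.nonsing_inv_mul _ (isUnit_det_star hu)]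
        noncomm_ring
      _ = _ := by rw [expI_neg_mul_expI, mul_one]
  rw [higgs, logDerivR, fderiv_apply_snd (differentiableAt_approxMetric hp r) hd,
    inv_approxMetric, e1, smul_smul]
  have : (1 / (2 * I) : ℂ) * (2 * I) = 1 := by
    field_simp
  rw [this, one_smul]

/-- The adjoint of the hypothesis is `∂_w (p*) = -p* a*`; hence `p*` can be cancelled from `H⁻¹ ∂_w
H`. It is applied with `a = u⁻¹ ∂_w̄ u`. -/
theorem connW_approxMetric {a : Matrix n n ℂ} (hp : DifferentiableAt ℝ p w)
    (hu : IsUnit (p w).det) (ha : dwbar p w = -(a * p w)) (r : ℝ) :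
    connW (approxMetric ξ p) (w, r) =
      (p w)⁻¹ * (dw p w - expI ξ (-(2 * r)) * star a * expI ξ (2 * r) * p w) := by
  have hH := differentiableAt_approxMetric (ξ := ξ) hp r
  have hs := differentiableAt_star hp
  have h1 : (1 / 2 : ℂ) • (fderiv ℝ (approxMetric ξ p) (w, r) (1, 0) -
      I • fderiv ℝ (approxMetric ξ p) (w, r) (I, 0)) =
      dw (fun z => star (p z) * expI ξ (2 * r) * p z) w := by
    rw [fderiv_apply_fst hH, fderiv_apply_fst hH]
    rfl
  have h2 : DifferentiableAt ℝ (fun z => star (p z) * expI ξ (2 * r)) w := hs.mul_const _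
  rw [connW, h1, dw_mul h2 hp, dw_mul hs (differentiableAt_const _), dw_const, dw_star, ha,
    inv_approxMetric, star_neg, star_mul]
  have e0 := Matrix.nonsing_inv_mul _ (isUnit_det_star hu)
  dsimp only
  calc _ = (p w)⁻¹ * expI ξ (-(2 * r)) * ((star (p w))⁻¹ * star (p w)) *
        (expI ξ (2 * r) * dw p w - star a * expI ξ (2 * r) * p w) := by noncomm_ring
    _ = (p w)⁻¹ * ((expI ξ (-(2 * r)) * expI ξ (2 * r)) * dw p w -
        expI ξ (-(2 * r)) * star a * expI ξ (2 * r) * p w) := by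
      rw [e0]
      noncomm_ring
    _ = _ := by rw [expI_neg_mul_expI, one_mul]

/-- Along a sphere `A = A_w dw`, so `A ∧ A` vanishes and the `∂_w A_w` terms cancel by antisymmetry.
The scalar factor is the value of `dw̄ ∧ dw` on `(v, v')`. -/
theorem curv_eq_of_differentiableAt {H : ℂ × ℝ → Matrix n n ℂ} {r : ℝ}
    (hH : DifferentiableAt ℝ (connW H) (w, r)) (v v' : ℂ) :
    curv H (w, r) (v, 0) (v', 0) =
      ((starRingEnd ℂ) v * v' - v * (starRingEnd ℂ) v') • dwbar (fun z => connW H (z, r)) w := by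
  have h1 : ∀ x : ℂ, (fun q => conn H q (x, 0)) = fun q => x • connW H q := fun x => by
    funext q
    simp [conn]
  have h2 : ∀ x y : ℂ, fderiv ℝ (fun q => x • connW H q) (w, r) (y, 0) =
      x • (y • dw (fun z => connW H (z, r)) w +
        (starRingEnd ℂ) y • dwbar (fun z => connW H (z, r)) w) := by
    intro x y
    have h3 : fderiv ℝ (fun q => x • connW H q) (w, r) = x • fderiv ℝ (connW H) (w, r) :=
      (hH.hasFDerivAt.const_smul x).fderiv
    rw [h3, _root_.smul_apply, fderiv_apply_fst hH, fderiv_eq_dw_add_dwbar]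
  rw [curv, h1, h1, h2, h2]
  have h3 : ⁅conn H (w, r) (v, 0), conn H (w, r) (v', 0)⁆ = 0 := by
    simp only [conn, zero_smul, add_zero, Ring.lie_def, smul_mul_assoc, mul_smul_comm]
    rw [smul_comm, sub_self]
  rw [h3]
  module

/-- The curvature of the approximate metric on the sphere of radius `r`, where
`a = u⁻¹ ∂_w̄ u = -∂_w̄ p p⁻¹`. -/
theorem dwbar_connW_approxMetric {a : ℂ → Matrix n n ℂ} (ha : ContDiffAt ℝ ∞ a w)
    (hp : ContDiffAt ℝ ∞ p w) (hdet : ∀ᶠ z in 𝓝 w, IsUnit (p z).det)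
    (hap : ∀ᶠ z in 𝓝 w, dwbar p z = -(a z * p z)) (r : ℝ) :
    DifferentiableAt ℝ (connW (approxMetric ξ p)) (w, r) ∧
    dwbar (fun z => connW (approxMetric ξ p) (z, r)) w =
      (p w)⁻¹ * (-dw a w - expI ξ (-(2 * r)) * star (dw a w) * expI ξ (2 * r) -
        ⁅a w, expI ξ (-(2 * r)) * star (a w) * expI ξ (2 * r)⁆) * p w := by
  have hpd : DifferentiableAt ℝ p w := hp.differentiableAt (by simp)
  have had : DifferentiableAt ℝ a w := ha.differentiableAt (by simp)
  have hdwp : DifferentiableAt ℝ (fun z => dw p z) w :=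
    (contDiffAt_dw hp).differentiableAt (by simp)
  have hsa := differentiableAt_star had
  have hw := hdet.self_of_nhds
  have hinv := differentiableAt_inv hpd hw
  have hev : ∀ᶠ z in 𝓝 w, ∀ t : ℝ, connW (approxMetric ξ p) (z, t) =
      (p z)⁻¹ * (dw p z - expI ξ (-(2 * t)) * star (a z) * expI ξ (2 * t) * p z) := by
    have h1 : ContDiffAt ℝ 1 p w := hp.of_le (by exact_mod_cast le_top)
    filter_upwards [hdet, hap, h1.eventually (by simp)] with z hz hz' hz'' t
    exact connW_approxMetric (hz''.differentiableAt (by simp)) hz hz' t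
  refine ⟨?_, ?_⟩
  · have hfst : ∀ {g : ℂ → Matrix n n ℂ}, DifferentiableAt ℝ g w →
        DifferentiableAt ℝ (fun q : ℂ × ℝ => g q.1) (w, r) := fun {g} hg =>
      DifferentiableAt.comp (w, r) (f := Prod.fst) (g := g) hg differentiableAt_fst
    have h3 : DifferentiableAt ℝ (fun q : ℂ × ℝ => expI ξ (2 * q.2)) (w, r) :=
      DifferentiableAt.comp (w, r) (f := fun q : ℂ × ℝ => 2 * q.2) (g := expI ξ)
        (differentiableAt_expI ξ _) (differentiableAt_snd.const_mul 2)
    have h4 : DifferentiableAt ℝ (fun q : ℂ × ℝ => expI ξ (-(2 * q.2))) (w, r) :=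
      DifferentiableAt.comp (w, r) (f := fun q : ℂ × ℝ => -(2 * q.2)) (g := expI ξ)
        (differentiableAt_expI ξ _) (differentiableAt_snd.const_mul 2).neg
    have h5 : DifferentiableAt ℝ (fun q : ℂ × ℝ => (p q.1)⁻¹ *
        (dw p q.1 - expI ξ (-(2 * q.2)) * star (a q.1) * expI ξ (2 * q.2) * p q.1)) (w, r) :=
      (hfst hinv).mul ((hfst hdwp).sub (((h4.mul (hfst hsa)).mul h3).mul (hfst hpd)))
    refine h5.congr_of_eventuallyEq ?_
    exact (continuous_fst.tendsto (w, r)).eventually hev |>.mono fun q hq => hq q.2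
  · rw [dwbar_congr (hev.mono fun z hz => hz r)]
    have k1 : DifferentiableAt ℝ (fun z => expI ξ (-(2 * r)) * star (a z)) w := hsa.const_mul _
    have k2 : DifferentiableAt ℝ (fun z => expI ξ (-(2 * r)) * star (a z) * expI ξ (2 * r)) w :=
      k1.mul_const _
    have k3 : DifferentiableAt ℝ
        (fun z => expI ξ (-(2 * r)) * star (a z) * expI ξ (2 * r) * p z) w := k2.mul hpd
    have k4 : DifferentiableAt ℝ
        (fun z => dw p z - expI ξ (-(2 * r)) * star (a z) * expI ξ (2 * r) * p z) w := hdwp.sub k3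
    -- Exchanging the derivatives brings in `∂_w (a p)`; its `a ∂_w p` part cancels against the
    -- derivative of `p⁻¹` in the final expansion.
    have k5 : dwbar (fun z => dw p z) w = -(dw a w * p w + a w * dw p w) := by
      rw [show dwbar (fun z => dw p z) w = dw (fun z => dwbar p z) w from dwbar_dw_comm hp,
        dw_congr hap, dw_neg, dw_mul had hpd]
    rw [dwbar_mul hinv k4, dwbar_sub hdwp k3, dwbar_mul k2 hpd,
      dwbar_mul k1 (differentiableAt_const _), dwbar_mul (differentiableAt_const _) hsa,
      dwbar_const, dwbar_const, dwbar_star, dwbar_inv hpd hdet, hap.self_of_nhds, k5, Ring.lie_def]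
    have e0 : (p w)⁻¹ * -(a w * p w) * (p w)⁻¹ = -((p w)⁻¹ * a w) := by
      rw [mul_assoc, neg_mul, Matrix.mul_nonsing_inv_cancel_right _ _ hw, mul_neg]
    rw [e0]
    noncomm_ring

end Curvature

/-! ### Limit of the curvature in the unitary gauge -/

section Limit

variable {n : Type*} [Fintype n] [DecidableEq n] {G : Subgroup (Matrix.unitaryGroup n ℂ)}
  {ξ : Matrix n n ℂ}

theorem conj_expI_mem (hξ : ξ ∈ lieAlg G) {Z : Matrix n n ℂ} (hZ : Z ∈ lieAlgC G) (r : ℝ) :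
    expI ξ r * Z * expI ξ (-r) ∈ lieAlgC G := by
  rw [← inv_expI]
  exact (NormalizesC.expI hξ r).conj_mem hZ

theorem conj_expI_self (ξ : Matrix n n ℂ) (r : ℝ) : expI ξ r * ξ * expI ξ (-r) = ξ := by
  rw [← (commute_expI ξ r).eq, mul_assoc, expI_mul_expI_neg, mul_one]

theorem killing_conj_expI (hξ : ξ ∈ lieAlg G) {Z : Matrix n n ℂ} (hZ : Z ∈ lieAlgC G) (r : ℝ) :
    killing G ξ (expI ξ r * Z * expI ξ (-r)) = killing G ξ Z := by
  have h := (NormalizesC.expI hξ r).killing_conj (mem_lieAlgC hξ) hZ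
  rwa [inv_expI, conj_expI_self] at h

theorem star_conj_expI (hξ : star ξ = -ξ) (Z : Matrix n n ℂ) (r : ℝ) :
    star (expI ξ r * Z * expI ξ (-r)) = expI ξ (-r) * star Z * expI ξ r := by
  rw [star_mul, star_mul, star_expI hξ, star_expI hξ, mul_assoc]

/-- The pairing with `ξ` of the limit of `exp(iξr) Z exp(-iξr)` is the pairing of `ξ` and `Z`. -/
theorem killing_limit (hξ : ξ ∈ lieAlg G) {Z L : Matrix n n ℂ} (hZ : Z ∈ lieAlgC G)
    (hL : Tendsto (fun r : ℝ => expI ξ r * Z * expI ξ (-r)) atTop (𝓝 L)) :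
    L ∈ lieAlgC G ∧ killing G ξ L = killing G ξ Z ∧
      killing G ξ (star L) = killing G ξ (star Z) := by
  obtain ⟨ℓ, hℓ⟩ := exists_killing_eq (mem_lieAlgC hξ)
  have hmem : L ∈ lieAlgC G :=
    isClosed_lieAlgC.mem_of_tendsto hL (Eventually.of_forall fun r => conj_expI_mem hξ hZ r)
  refine ⟨hmem, ?_, ?_⟩
  · rw [hℓ _ hmem]
    refine tendsto_nhds_unique ((ℓ.continuous.tendsto L).comp hL) ?_
    refine tendsto_const_nhds.congr fun r => ?_
    rw [Function.comp_apply, ← hℓ _ (conj_expI_mem hξ hZ r), killing_conj_expI hξ hZ]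
  -- As `exp(iξr)` is Hermitian, taking adjoints replaces `r` by `-r` in the conjugation, and the
  -- pairing with `ξ` is invariant for either sign.
  · rw [hℓ _ (star_mem_lieAlgC hmem)]
    refine tendsto_nhds_unique ((ℓ.continuous.tendsto (star L)).comp hL.star) ?_
    refine tendsto_const_nhds.congr fun r => ?_
    rw [Function.comp_apply, ← hℓ _ (star_mem_lieAlgC (conj_expI_mem hξ hZ r)),
      star_conj_expI (star_eq_neg_of_mem_lieAlg hξ)]
    have := killing_conj_expI hξ (star_mem_lieAlgC hZ) (-r)
    rw [neg_neg] at this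
    exact this.symm

/-- The limit of the curvature in the unitary gauge, where `a = u⁻¹ ∂_w̄ u` and `N = ∂_w a`. -/
theorem exists_tendsto_curvature (hξ : ξ ∈ lieAlg G) {a N : Matrix n n ℂ} (ha : a ∈ lieAlgC G)
    (hN : N ∈ lieAlgC G) (ha' : BoundedAlong ξ a) (hN' : BoundedAlong ξ N) :
    ∃ K ∈ lieAlgC G, star K = K ∧ Tendsto (fun r : ℝ => expI ξ r *
        (-N - expI ξ (-(2 * r)) * star N * expI ξ (2 * r) -
          ⁅a, expI ξ (-(2 * r)) * star a * expI ξ (2 * r)⁆) * expI ξ (-r)) atTop (𝓝 K) ∧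
      killing G ξ K = killing G ξ (-(N + star N)) := by
  have hs := star_eq_neg_of_mem_lieAlg hξ
  obtain ⟨A, hA, hcomm⟩ := ha'.exists_tendsto hs
  obtain ⟨M, hM, -⟩ := hN'.exists_tendsto hs
  obtain ⟨mA, -, -⟩ := killing_limit hξ ha hA
  obtain ⟨mM, kM, kM'⟩ := killing_limit hξ hN hM
  have mA' := star_mem_lieAlgC mA
  have mM' := star_mem_lieAlgC mM
  have mb := (lieAlgC G).lie_mem mA mA'
  refine ⟨-M - star M - ⁅A, star A⁆, sub_mem (sub_mem (neg_mem mM) mM') mb, ?_, ?_, ?_⟩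
  · simp only [Ring.lie_def, star_sub, star_neg, star_star, star_mul]
    abel
  -- Half of the factor `exp(∓2iξr)` is absorbed by the outer conjugation, so each starred term is
  -- the adjoint of a convergent conjugate.
  · have hlim : Tendsto (fun r : ℝ => -(expI ξ r * N * expI ξ (-r)) -
        star (expI ξ r * N * expI ξ (-r)) -
        ((expI ξ r * a * expI ξ (-r)) * star (expI ξ r * a * expI ξ (-r)) -
          star (expI ξ r * a * expI ξ (-r)) * (expI ξ r * a * expI ξ (-r)))) atTop
        (𝓝 (-M - star M - (A * star A - star A * A))) :=
      (hM.neg.sub hM.star).sub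
        ((hA.mul hA.star).sub (hA.star.mul hA))
    rw [Ring.lie_def]
    refine hlim.congr fun r => ?_
    rw [star_conj_expI hs, star_conj_expI hs, Ring.lie_def]
    have e1 : expI ξ (2 * r) = expI ξ r * expI ξ r := by rw [two_mul, expI_add]
    have e2 : expI ξ (-(2 * r)) = expI ξ (-r) * expI ξ (-r) := by
      rw [two_mul, neg_add, expI_add]
    have e3 := expI_mul_expI_neg ξ r
    rw [e1, e2]
    generalize expI ξ r = e at *
    generalize expI ξ (-r) = e' at *
    have f1 : ∀ X : Matrix n n ℂ, e * (e' * X) = X := fun X => by rw [← mul_assoc, e3, one_mul]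
    simp only [mul_sub, sub_mul, mul_neg, neg_mul, mul_assoc, f1, e3, mul_one]
  · obtain ⟨ℓ, hℓ⟩ := exists_killing_eq (mem_lieAlgC hξ)
    have kb : killing G ξ ⁅A, star A⁆ = 0 := killing_lie_eq_zero (mem_lieAlgC hξ) mA mA' hcomm
    rw [hℓ _ mM, hℓ _ hN] at kM
    rw [hℓ _ mM', hℓ _ (star_mem_lieAlgC hN)] at kM'
    rw [hℓ _ mb] at kb
    rw [hℓ _ (sub_mem (sub_mem (neg_mem mM) mM') mb),
      hℓ _ (neg_mem (add_mem hN (star_mem_lieAlgC hN))), map_sub, map_sub, map_neg, map_neg,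
      map_add, kM, kM', kb]
    ring

end Limit

end HypMonopole

/-! ### The boundary values of the approximate monopole -/

theorem mainTheorem4 {n : Type*} [Fintype n] [DecidableEq n]
    (G : Subgroup (Matrix.unitaryGroup n ℂ))
    (hG : IsClosed (G : Set (Matrix.unitaryGroup n ℂ)))
    (ξ : Matrix n n ℂ) (hξ : ξ ∈ HypMonopole.lieAlg G)
    (f : OnePoint ℂ → Matrix n n ℂ) (hf : HypMonopole.IsHolomorphicMap G ξ f)
    (i : Bool) (U : Set ℂ) (hU : IsOpen U) (u p : ℂ → Matrix n n ℂ)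
    (hup : HypMonopole.IsLift G ξ f i U u p) (w : ℂ) (hw : w ∈ U) (v v' : ℂ) :
    -- the Lie algebra valued two-form `F_A` (on the sphere of radius `r`) and the Higgs field
    (∀ r : ℝ,
      HypMonopole.curv (HypMonopole.approxMetric ξ p) (w, r) (v, 0) (v', 0)
        ∈ HypMonopole.lieAlgC G ∧
      HypMonopole.higgs (HypMonopole.approxMetric ξ p) (w, r) ∈ HypMonopole.lieAlgC G) ∧
    -- the gauge invariant two-form `⟨F_A, Φ⟩` on the sphere of radius `r` tends to `f^*ω`
    Tendsto (fun r : ℝ => HypMonopole.killing G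
        (HypMonopole.curv (HypMonopole.approxMetric ξ p) (w, r) (v, 0) (v', 0))
        (HypMonopole.higgs (HypMonopole.approxMetric ξ p) (w, r)))
      atTop
      (𝓝 (HypMonopole.pullbackKK G (fun z => f (HypMonopole.sphereChart i z)) w v v')) ∧
    -- in the unitary gauge `F_A` and `Φ` themselves have limits, which pair to `f^*ω`
    (∃ Finf ∈ HypMonopole.lieAlg G,
      Tendsto (fun r : ℝ => HypMonopole.unitaryGauge ξ p (w, r) *
          HypMonopole.curv (HypMonopole.approxMetric ξ p) (w, r) (v, 0) (v', 0) *
          (HypMonopole.unitaryGauge ξ p (w, r))⁻¹) atTop (𝓝 Finf) ∧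
      Tendsto (fun r : ℝ => HypMonopole.unitaryGauge ξ p (w, r) *
          HypMonopole.higgs (HypMonopole.approxMetric ξ p) (w, r) *
          (HypMonopole.unitaryGauge ξ p (w, r))⁻¹) atTop (𝓝 ξ) ∧
      HypMonopole.killing G Finf ξ =
        HypMonopole.pullbackKK G (fun z => f (HypMonopole.sphereChart i z)) w v v') ∧
    -- `f^*ω = ⟨ξ, [u⁻¹ ∂_w u, u⁻¹ ∂_w̄ u]⟩ dw̄ ∧ dw`
    HypMonopole.pullbackKK G (fun z => f (HypMonopole.sphereChart i z)) w v v' =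
      HypMonopole.killing G ξ
          ⁅(u w)⁻¹ * HypMonopole.dw u w, (u w)⁻¹ * HypMonopole.dwbar u w⁆ *
        ((starRingEnd ℂ) v * v' - v * (starRingEnd ℂ) v') := by
  open HypMonopole in
  have hn := hU.mem_nhds hw
  have hu : ContDiffAt ℝ ∞ u w := hup.smooth_u.contDiffAt hn
  have hp : ContDiffAt ℝ ∞ p w := hup.smooth_p.contDiffAt hn
  have hm : ∀ᶠ z in 𝓝 w, u z ∈ matSet G := eventually_of_mem hn hup.mem_u
  have hdet := hup.isUnit_det hw
  have hpN := NormalizesC.of_mem_complexGroup (hup.mem_p w hw).1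
  set a : ℂ → Matrix n n ℂ := fun z => star (u z) * dwbar u z with ha_def
  have hac : ContDiffAt ℝ ∞ a w :=
    ContDiffAt.mul
      ((starL' ℝ : Matrix n n ℂ ≃L[ℝ] Matrix n n ℂ).contDiff.contDiffAt.comp w hu)
      (contDiffAt_dwbar hu)
  have had : DifferentiableAt ℝ a w := hac.differentiableAt (by simp)
  have hamem : ∀ z ∈ U, a z ∈ lieAlgC G := fun z hz =>
    star_mul_dwbar_mem ((hup.smooth_u.contDiffAt (hU.mem_nhds hz)).differentiableAt (by simp))
      (eventually_of_mem (hU.mem_nhds hz) hup.mem_u)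
  have habd : ∀ z ∈ U, a z ∈ boundedSubalgebra ξ := fun z hz =>
    hup.bounded_star_mul_dwbar hU hz
  have hN : dw a w ∈ lieAlgC G :=
    dw_mem (lieAlgC G).toSubmodule had (eventually_of_mem hn hamem)
  have hN' : dw a w ∈ boundedSubalgebra ξ :=
    dw_mem (Subalgebra.toSubmodule (boundedSubalgebra ξ)) had (eventually_of_mem hn habd)
  obtain ⟨K, hK, hKs, hKlim, hKξ⟩ :=
    exists_tendsto_curvature hξ (hamem w hw) hN (habd w hw) hN'
  have hpull := hup.pullbackKK_eq hU hξ hw v v'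
  set c : ℂ := (starRingEnd ℂ) v * v' - v * (starRingEnd ℂ) v' with hc
  set Kr : ℝ → Matrix n n ℂ := fun r => -dw a w - expI ξ (-(2 * r)) * star (dw a w) *
    expI ξ (2 * r) - ⁅a w, expI ξ (-(2 * r)) * star (a w) * expI ξ (2 * r)⁆ with hKr
  have hcurv : ∀ r : ℝ, curv (approxMetric ξ p) (w, r) (v, 0) (v', 0) =
      c • ((p w)⁻¹ * Kr r * p w) := by
    intro r
    obtain ⟨h1, h2⟩ := dwbar_connW_approxMetric (ξ := ξ) hac hp
      (eventually_of_mem hn fun z hz => hup.isUnit_det hz)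
      (eventually_of_mem hn fun z hz => hup.dwbar_p hU hz) r
    rw [curv_eq_of_differentiableAt h1, h2]
  have hhiggs : ∀ r : ℝ, higgs (approxMetric ξ p) (w, r) = (p w)⁻¹ * ξ * p w := fun r =>
    higgs_approxMetric (hp.differentiableAt (by simp)) hdet r
  have hKrmem : ∀ r, Kr r ∈ lieAlgC G := by
    have key : ∀ r : ℝ, ∀ Z ∈ lieAlgC G,
        expI ξ (-(2 * r)) * star Z * expI ξ (2 * r) ∈ lieAlgC G := fun r Z hZ => by
      have := conj_expI_mem hξ (star_mem_lieAlgC hZ) (-(2 * r))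
      rwa [neg_neg] at this
    exact fun r => sub_mem (sub_mem (neg_mem hN) (key r _ hN))
      ((lieAlgC G).lie_mem (hamem w hw) (key r _ (hamem w hw)))
  have hFmem : ∀ r : ℝ, curv (approxMetric ξ p) (w, r) (v, 0) (v', 0) ∈ lieAlgC G := fun r => by
    rw [hcurv]
    exact (lieAlgC G).smul_mem _ (hpN.conj_inv_mem (hKrmem r))
  have hΦmem : ∀ r : ℝ, higgs (approxMetric ξ p) (w, r) ∈ lieAlgC G := fun r => by
    rw [hhiggs]
    exact hpN.conj_inv_mem (mem_lieAlgC hξ)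
  -- Curvature and Higgs field both have the form `p⁻¹ X p`, so in the unitary gauge only the
  -- conjugation by `exp(iξr)` remains.
  have hgauge : ∀ (r : ℝ) (X : Matrix n n ℂ),
      unitaryGauge ξ p (w, r) * ((p w)⁻¹ * X * p w) * (unitaryGauge ξ p (w, r))⁻¹ =
        expI ξ r * X * expI ξ (-r) := by
    intro r X
    rw [unitaryGauge, Matrix.mul_inv_rev, inv_expI]
    dsimp only
    calc _ = expI ξ r * (p w * (p w)⁻¹) * X * (p w * (p w)⁻¹) * expI ξ (-r) := by noncomm_ring
      _ = _ := by rw [Matrix.mul_nonsing_inv _ hdet, mul_one, mul_one]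
  have hFg : ∀ r : ℝ, unitaryGauge ξ p (w, r) *
      curv (approxMetric ξ p) (w, r) (v, 0) (v', 0) * (unitaryGauge ξ p (w, r))⁻¹ =
        c • (expI ξ r * Kr r * expI ξ (-r)) := fun r => by
    rw [hcurv, mul_smul_comm, smul_mul_assoc, hgauge]
  have hΦg : ∀ r : ℝ, unitaryGauge ξ p (w, r) *
      higgs (approxMetric ξ p) (w, r) * (unitaryGauge ξ p (w, r))⁻¹ = ξ := fun r => by
    rw [hhiggs, hgauge, conj_expI_self]
  have hFlim : Tendsto (fun r : ℝ => unitaryGauge ξ p (w, r) *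
      curv (approxMetric ξ p) (w, r) (v, 0) (v', 0) * (unitaryGauge ξ p (w, r))⁻¹) atTop
      (𝓝 (c • K)) := by
    simp only [hFg]
    exact hKlim.const_smul c
  have hcK : c • K ∈ lieAlgC G := (lieAlgC G).smul_mem _ hK
  obtain ⟨ℓ, hℓ⟩ := exists_killing_eq (mem_lieAlgC hξ)
  have hpair : killing G (c • K) ξ =
      pullbackKK G (fun z => f (sphereChart i z)) w v v' := by
    have hmc := maurerCartan hu hm
    have hba := (lieAlgC G).lie_mem (star_mul_dw_mem (hu.differentiableAt (by simp)) hm) (hamem w hw)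
    rw [killing_comm, hℓ _ hcK, map_smul, ← hℓ _ hK, hKξ, hpull, hmc, neg_neg, smul_eq_mul,
      mul_comm]
  refine ⟨fun r => ⟨hFmem r, hΦmem r⟩, ?_, ⟨c • K, ?_, hFlim, ?_, hpair⟩, ?_⟩
  -- By invariance under conjugation by `s`, `⟨F_A, Φ⟩` equals `⟨s F_A s⁻¹, ξ⟩` for every `r`;
  -- continuity of the pairing with `ξ` gives the limit.
  · rw [← hpair, killing_comm, hℓ _ hcK]
    refine ((ℓ.continuous.tendsto _).comp hFlim).congr fun r => ?_
    have hs : NormalizesC G (unitaryGauge ξ p (w, r)) := (NormalizesC.expI hξ r).mul hpN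
    have h := hs.killing_conj (hFmem r) (hΦmem r)
    rw [hΦg r] at h
    rw [← h, Function.comp_apply, ← hℓ _ (hs.conj_mem (hFmem r)), killing_comm]
  -- The factor `c` is purely imaginary and `K` is Hermitian, so `c • K` is skew-Hermitian.
  · refine mem_lieAlg_of_star_eq_neg hcK ?_
    rw [star_smul, hKs, ← neg_smul]
    congr 1
    simp [hc, mul_comm]
  · simp only [hΦg]
    exact tendsto_const_nhds
  · rw [hpull, inv_eq_star_of_mem_matSet (hup.mem_u w hw)]
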